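/- Let $\Bbbk$ be a field of characteristic $p>0$, $R=\Bbbk[x_1,\dots,x_n]$, $e\ge 1$, $q=p^e$, $u\in R$, and let $\mathfrak p$ be a prime ideal of $R$. Let $T$ be $R$ or $R_{\mathfrak p}$. For an ideal $I\subseteq T$ let $I^{[q]}$ be the ideal generated by the $q$-th powers of the elements of $I$, let $I_e(I)$ be the smallest ideal $J$ with $I\subseteq J^{[q]}$, and let $I^{\star^e u}$ be the smallest ideal $B\supseteq I$ with $uB\subseteq B^{[q]}$. The Katzman–Schwede algorithm over $T$ for $u$ starts with $\mathcal A=\{0\}$ and $\mathcal B=\emptyset$. While $\mathcal A\ne\mathcal B$, it picks any $P\in\mathcal A\setminus\mathcal B$, adds to $\mathcal A$ the minimal primes of $J^{\star^e u}$ and of $B^{\star^e u}$, where $J\supseteq P$ is the radical ideal whose image in $T/P$ defines the singular (non-regular) locus of $T/P$ and $B=(uT+P^{[q]}):(P^{[q]}:P)$, and adds $P$ to $\mathcal B$. When $\mathcal A=\mathcal B$ it outputs $\mathcal A_T=\mathcal A$. **Theorem.** The Katzman–Schwede algorithm commutes with localization. Over $R$ and over $R_{\mathfrak p}$ the loop can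 be run until it stops, its output $\mathcal A_R$, respectively $\mathcal A_{R_{\mathfrak p}}$ (for the image of $u$), does not depend on the choices made, and $$\mathcal A_{R_{\mathfrak p}}=\{PR_{\mathfrak p}\mid P\in\mathcal A_R,\ P\subseteq\mathfrak p\}.$$ The same equality holds after one discards from $\mathcal A_R$ the primes that contain $I_e(uR)$ and from $\mathcal A_{R_{\mathfrak p}}$ those that contain $I_e(uR_{\mathfrak p})$. It also holds for the sets that the algorithm is meant to list. Let $C$ be a basis of $\Bbbk$ over $\Bbbk^{q}$ with $1\in C$, and let $\pi_e:F^e_*R\to R$ be the trace map, i.e. the projection onto the summand of $F^e_*(x_1\cdots x_n)^{q-1}$ with respect to the $R$-basis $F^e_*(\lambda x_1^{\alpha_1}\cdots x_n^{\alpha_n})$, $\lambda\in C$, $0\le\alpha_i<q$, of $F^e_*R$. Put $\phi=\pi_e(F^e_*u\,\cdot\,)$, and let $\phi_{\mathfrak p}:F^e_*R_{\mathfrak p}\to R_{\mathfrak p}$ be the induced map. Then the primes $Q$ of $R_{\mathfrak p}$ with $\phi_{\mathfrak p}(F^e_*Q)\subseteq Q$ and $I_e(uR_{\mathfrak p})\not\subseteq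 Q$ are exactly the ideals $PR_{\mathfrak p}$, where $P\subseteq\mathfrak p$ is a prime of $R$ with $\phi(F^e_*P)\subseteq P$ and $I_e(uR)\not\subseteq P$. -/

import Mathlib

namespace KatzmanSchwede

section General

variable {R : Type*} [CommRing R]

/-- The Frobenius power `I^[q]`: the ideal generated by the `q`-th powers of the elements of `I`. -/
def frobeniusPower (q : ℕ) (I : Ideal R) : Ideal R :=
  Ideal.span ((fun r : R => r ^ q) '' (I : Set R))

/-- `I_e(A)`, for `q = p ^ e`: the smallest ideal `J` with `A ⊆ J^[q]`. It is given as the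
intersection of all such `J`. -/
def Ie (q : ℕ) (A : Ideal R) : Ideal R :=
  sInf {J : Ideal R | A ≤ frobeniusPower q J}

/-- The star closure of `A` with respect to `u`, for `q = p ^ e`: the smallest ideal `B`
containing `A` with `u B ⊆ B^[q]`. It is given as the intersection of all such `B`. -/
def starClosure (q : ℕ) (u : R) (A : Ideal R) : Ideal R :=
  sInf {B : Ideal R | A ≤ B ∧ Ideal.span {u} * B ≤ frobeniusPower q B}

/-- The singular locus of `S`: the primes at which the local ring of `S` is not regular. -/
def singularLocus (S : Type*) [CommRing S] : Set (PrimeSpectrum S) :=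
  {x | ¬ IsRegularLocalRing (Localization.AtPrime x.asIdeal)}

/-- The ideal `J` of `R`, containing `P`, whose image in `R/P` is the (radical) ideal that defines
the singular locus of `R/P`. -/
def singularIdeal (P : Ideal R) : Ideal R :=
  (PrimeSpectrum.vanishingIdeal (singularLocus (R ⧸ P))).comap (Ideal.Quotient.mk P)

/-- The ideal `(uR + P^[q]) : (P^[q] : P)`. -/
def colonIdeal (q : ℕ) (u : R) (P : Ideal R) : Ideal R :=
  (Ideal.span {u} ⊔ frobeniusPower q P).colon
    ((frobeniusPower q P).colon (P : Set R) : Set R)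

/-- The primes that one pass of the loop adds to the list when it treats `P`. -/
def newPrimes (q : ℕ) (u : R) (P : Ideal R) : Set (Ideal R) :=
  (starClosure q u (singularIdeal P)).minimalPrimes ∪
    (starClosure q u (colonIdeal q u P)).minimalPrimes

/-- A state of the algorithm: the list `found` of primes found so far, and the list `done` of
those that were already treated. -/
structure State (R : Type*) [CommRing R] where
  found : Set (Ideal R)
  done : Set (Ideal R)

/-- One pass of the loop: pick any prime `P` that was found and not yet treated, add the new
primes to the first list and `P` to the second. -/
inductive Step (q : ℕ) (u : R) : State R → State R → Prop
  | pass (A B : Set (Ideal R)) (P : Ideal R) (hA : P ∈ A) (hB : P ∉ B) :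
      Step q u ⟨A, B⟩ ⟨A ∪ newPrimes q u P, insert P B⟩

/-- `A` is an output of the algorithm: some run of the loop, started with the lists `{0}` and `∅`,
stops (that is, reaches a state in which both lists agree) with the list `A`. -/
def IsOutput (q : ℕ) (u : R) (A : Set (Ideal R)) : Prop :=
  Relation.ReflTransGen (Step q u) ⟨{⊥}, ∅⟩ ⟨A, A⟩

/-- `J` is `φ`-compatible: `φ(F_*^e J) ⊆ J`. As a set `F_*^e R` is `R`, so a map `F_*^e R → R` is
given by its underlying map `R → R`. -/
def IsCompatible (φ : R → R) (J : Ideal R) : Prop :=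
  ∀ x ∈ J, φ x ∈ J

/-- The `φ`-compatible primes that do not contain `I_e(uR)`, for `φ = π(F_*^e u -)`. -/
def compatiblePrimes (q : ℕ) (π : R → R) (u : R) : Set (Ideal R) :=
  {P | P.IsPrime ∧ IsCompatible (fun x => π (u * x)) P ∧ ¬ Ie q (Ideal.span {u}) ≤ P}

/-- For a set `X` of ideals of `R`, the set of the extensions `P R_𝔭` with `P ∈ X`, `P ⊆ 𝔭`. -/
def extensions (𝔭 : Ideal R) [𝔭.IsPrime] (X : Set (Ideal R)) :
    Set (Ideal (Localization.AtPrime 𝔭)) :=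
  {Q | ∃ P ∈ X, P ≤ 𝔭 ∧ Q = P.map (algebraMap R (Localization.AtPrime 𝔭))}

/-- The map `F_*^e R_𝔭 → R_𝔭` induced by an `R`-linear map `π : F_*^e R → R`, for `q = p ^ e`:
`r / s = (r s^(q-1)) / s^q` goes to `π(r s^(q-1)) / s`. -/
noncomputable def localizedMap (q : ℕ) (𝔭 : Ideal R) [𝔭.IsPrime] (π : R → R)
    (z : Localization.AtPrime 𝔭) : Localization.AtPrime 𝔭 :=
  IsLocalization.mk' (Localization.AtPrime 𝔭)
    (π ((IsLocalization.sec 𝔭.primeCompl z).1 *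
      ((IsLocalization.sec 𝔭.primeCompl z).2 : R) ^ (q - 1)))
    (IsLocalization.sec 𝔭.primeCompl z).2

end General

section Trace

variable {k : Type*} [Field k] (p : ℕ) [Fact p.Prime] [CharP k p] (e : ℕ)

/-- The subfield `k^(p^e)` of `k`. -/
abbrev powersSubfield (k : Type*) [Field k] (p : ℕ) [Fact p.Prime] [CharP k p] (e : ℕ) :
    Subfield k :=
  (iterateFrobenius k p e).fieldRange

/-- For a basis `C` of `k` over `k^(p^e)`, the `p^e`-th root of the coefficient of `c` at the
basis element `C i₀`. -/
noncomputable def rootCoeff {ι : Type*} (C : Module.Basis ι (powersSubfield k p e) k) (i₀ : ι)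
    (c : k) : k :=
  Classical.choose (C.repr c i₀).2

/-- The trace map `π_e : F_*^e R → R` of `R = k[x_1, …, x_n]`. Here `F_*^e R` is free over `R` on
the elements `F_*^e (λ x^α)` with `λ` in the basis `C` of `k` over `k^(p^e)` and `0 ≤ α_i < p^e`,
and `π_e` is the projection onto the summand of `F_*^e (x_1 ⋯ x_n)^(p^e-1)` (`C i₀ = 1`). -/
noncomputable def traceMap {n : ℕ} {ι : Type*} (C : Module.Basis ι (powersSubfield k p e) k)
    (i₀ : ι) (f : MvPolynomial (Fin n) k) : MvPolynomial (Fin n) k :=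
  open Classical in
  ∑ m ∈ f.support,
    if ∀ i, m i % p ^ e = p ^ e - 1 then
      MvPolynomial.monomial (m.mapRange (fun a => a / p ^ e) (Nat.zero_div _))
        (rootCoeff p e C i₀ (f.coeff m))
    else 0

end Trace

end KatzmanSchwede

/-! Each ingredient of the loop commutes with localization at `𝔭`, so the whole loop does.

For `Ie` and `starClosure`: `F_*^e R` is free over `R`, so membership in `I^[q]` can be tested on
coordinates (`mem_frobeniusPower_iff`). Hence Frobenius powers commute with arbitrary intersections,
which makes the "smallest ideals" attain their defining property, and contraction from `R_𝔭`
respects Frobenius powers (`comap_frobeniusPower_le`). Colon ideals localize because the ideals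
involved are finitely generated.

For `singularIdeal` one must know that the regular locus of `R/P` is open. The field `k` is
arbitrary, so a Jacobian criterion is used over the prime field: `k[x]` is formally smooth over
`F_p`, and if `R/P` is regular at `Q`, then `P` is cut out near `Q` by elements whose matrix of
derivatives under suitable `F_p`-derivations of `R` has determinant outside `Q`. Both conditions
persist on a neighbourhood of `Q`.

The output of any terminating run is the set of `descendants` of `0` under the relation "new prime
of". New primes contain the prime they come from, so this set is finite in a Noetherian ring, and a
chain that ends inside `𝔭` lies inside `𝔭` throughout. The statement on compatible primes needs only
that a prime of `R_𝔭` is compatible exactly when its contraction is. -/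

namespace KatzmanSchwede

/-! ### Frobenius powers as extensions along the iterated Frobenius. -/

section FrobeniusPower

variable {R : Type*} [CommRing R] (p : ℕ) [Fact p.Prime] [CharP R p] (e : ℕ)

theorem frobeniusPower_eq_map (I : Ideal R) :
    frobeniusPower (p ^ e) I = I.map (iterateFrobenius R p e) := rfl

theorem pow_mem_frobeniusPower {q : ℕ} {I : Ideal R} {x : R} (hx : x ∈ I) :
    x ^ q ∈ frobeniusPower q I :=
  Ideal.subset_span ⟨x, hx, rfl⟩

theorem map_frobeniusPower {S : Type*} [CommRing S] (f : R →+* S) (I : Ideal R)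
    [CharP S p] :
    (frobeniusPower (p ^ e) I).map f = frobeniusPower (p ^ e) (I.map f) := by
  rw [frobeniusPower_eq_map, frobeniusPower_eq_map, Ideal.map_map, Ideal.map_map]
  congr 1
  ext x
  simp [iterateFrobenius_def]

end FrobeniusPower

/-! ### Freeness of `F_*^e k[x]` and coordinatewise tests. -/

section Coordinates

variable {k : Type*} [Field k] (p : ℕ) [Fact p.Prime] [CharP k p] (e : ℕ)
  {ι : Type*} (C : Module.Basis ι (powersSubfield k p e) k)

theorem rootCoeff_pow (i : ι) (c : k) : rootCoeff p e C i c ^ p ^ e = C.repr c i := by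
  have := Classical.choose_spec (C.repr c i).2
  rwa [iterateFrobenius_def] at this

theorem rootCoeff_eq_iff {i : ι} {c b : k} : rootCoeff p e C i c = b ↔ b ^ p ^ e = C.repr c i := by
  rw [← rootCoeff_pow]
  exact ⟨fun h => by rw [h], fun h => (iterateFrobenius_inj k p e (by
    simpa [iterateFrobenius_def] using h)).symm⟩

/-- The `q`-th roots of the coordinates of an element of `k` with respect to a basis of `k` over
`k ^ q`. -/
noncomputable def rootCoeffHom : k →+ ι →₀ k where
  toFun c := Finsupp.onFinset (C.repr c).support (fun i => rootCoeff p e C i c) (by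
    intro i hi
    rw [Finsupp.mem_support_iff]
    intro h
    apply hi
    rw [rootCoeff_eq_iff, h, zero_pow (pow_ne_zero _ (Fact.out : p.Prime).ne_zero)]
    rfl)
  map_zero' := by
    ext i
    simp [rootCoeff_eq_iff, (Fact.out : p.Prime).ne_zero]
  map_add' a b := by
    ext i
    simp only [Finsupp.onFinset_apply, Finsupp.add_apply]
    rw [rootCoeff_eq_iff, add_pow_expChar_pow, rootCoeff_pow, rootCoeff_pow]
    simp

@[simp] theorem rootCoeffHom_apply (i : ι) (c : k) :
    rootCoeffHom p e C c i = rootCoeff p e C i c := rfl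

theorem rootCoeffHom_pow_mul (a c : k) :
    rootCoeffHom p e C (a ^ p ^ e * c) = a • rootCoeffHom p e C c := by
  ext i
  simp only [rootCoeffHom_apply, Finsupp.smul_apply, smul_eq_mul]
  rw [rootCoeff_eq_iff, mul_pow, rootCoeff_pow]
  let a' : powersSubfield k p e := ⟨a ^ p ^ e, ⟨a, by simp [iterateFrobenius_def]⟩⟩
  have : a ^ p ^ e * c = a' • c := rfl
  rw [this, map_smul]
  rfl

theorem sum_rootCoeffHom (c : k) :
    ((rootCoeffHom p e C c).sum fun i a => a ^ p ^ e * C i) = c := by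
  conv_rhs => rw [← C.linearCombination_repr c, Finsupp.linearCombination_apply]
  rw [Finsupp.sum_of_support_subset (s := (C.repr c).support)]
  · rw [Finsupp.sum]
    refine Finset.sum_congr rfl fun i _ => ?_
    rw [rootCoeffHom_apply, rootCoeff_pow]
    rfl
  · intro i hi
    rw [Finsupp.mem_support_iff, rootCoeffHom_apply] at hi
    rw [Finsupp.mem_support_iff]
    intro h
    apply hi
    rw [rootCoeff_eq_iff, h, zero_pow (pow_ne_zero _ (Fact.out : p.Prime).ne_zero)]
    rfl
  · simp [(Fact.out : p.Prime).ne_zero]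

variable {n : ℕ}

/-- The quotients `m_i / q` of the exponents. -/
noncomputable abbrev expDiv (q : ℕ) (m : Fin n →₀ ℕ) : Fin n →₀ ℕ :=
  m.mapRange (fun a => a / q) (Nat.zero_div _)

/-- The remainders `m_i % q` of the exponents. -/
noncomputable abbrev expMod (q : ℕ) (m : Fin n →₀ ℕ) : Fin n →₀ ℕ :=
  m.mapRange (fun a => a % q) (Nat.zero_mod _)

/-- The coordinates of `c x^m` with respect to the basis `λ x^α` of `F_*^e k[x]`. -/
noncomputable def monomialCoords (m : Fin n →₀ ℕ) :
    k →+ (ι × (Fin n →₀ ℕ)) →₀ MvPolynomial (Fin n) k :=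
  (Finsupp.liftAddHom fun i =>
    (Finsupp.singleAddHom (i, expMod (p ^ e) m)).comp
      (MvPolynomial.monomial (expDiv (p ^ e) m)).toAddMonoidHom).comp (rootCoeffHom p e C)

/-- The coordinates of a polynomial with respect to the basis `λ x^α` of `F_*^e k[x]`. -/
noncomputable def frobeniusCoords :
    MvPolynomial (Fin n) k →+ (ι × (Fin n →₀ ℕ)) →₀ MvPolynomial (Fin n) k :=
  (Finsupp.liftAddHom (monomialCoords p e C)).comp
    (MvPolynomial.basisMonomials (Fin n) k).repr.toLinearMap.toAddMonoidHom

theorem frobeniusCoords_monomial (m : Fin n →₀ ℕ) (c : k) :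
    frobeniusCoords p e C (MvPolynomial.monomial m c) = monomialCoords p e C m c := by
  have : (MvPolynomial.basisMonomials (Fin n) k).repr (MvPolynomial.monomial m c) =
      Finsupp.single m c := by
    rw [← LinearEquiv.eq_symm_apply]
    simp [MvPolynomial.smul_monomial]
  rw [frobeniusCoords, AddMonoidHom.comp_apply, LinearMap.toAddMonoidHom_coe,
    LinearEquiv.coe_coe, this, Finsupp.liftAddHom_apply_single]

/-- The polynomial with given coordinates with respect to the basis `λ x^α` of `F_*^e k[x]`. -/
noncomputable def ofFrobeniusCoords :
    ((ι × (Fin n →₀ ℕ)) →₀ MvPolynomial (Fin n) k) →+ MvPolynomial (Fin n) k :=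
  Finsupp.liftAddHom fun b =>
    (AddMonoidHom.mulRight (MvPolynomial.monomial b.2 (C b.1))).comp
      (iterateFrobenius (MvPolynomial (Fin n) k) p e).toAddMonoidHom

theorem ofFrobeniusCoords_single (b : ι × (Fin n →₀ ℕ)) (x : MvPolynomial (Fin n) k) :
    ofFrobeniusCoords p e C (Finsupp.single b x) =
      x ^ p ^ e * MvPolynomial.monomial b.2 (C b.1) := by
  rw [ofFrobeniusCoords, Finsupp.liftAddHom_apply_single]
  rfl

theorem expDiv_add_expMod (q : ℕ) (m : Fin n →₀ ℕ) : q • expDiv q m + expMod q m = m := by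
  ext i
  simp [Nat.div_add_mod]

theorem ofFrobeniusCoords_frobeniusCoords (f : MvPolynomial (Fin n) k) :
    ofFrobeniusCoords p e C (frobeniusCoords p e C f) = f := by
  induction f using MvPolynomial.induction_on' with
  | add f g hf hg => rw [map_add, map_add, hf, hg]
  | monomial m c =>
    rw [frobeniusCoords_monomial, monomialCoords, AddMonoidHom.comp_apply,
      Finsupp.liftAddHom_apply, Finsupp.sum, map_sum]
    conv_rhs => rw [← sum_rootCoeffHom p e C c, Finsupp.sum, map_sum]
    refine Finset.sum_congr rfl fun i _ => ?_
    simp [ofFrobeniusCoords_single, MvPolynomial.monomial_pow, MvPolynomial.monomial_mul,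
      expDiv_add_expMod]

/-- This is `R`-linearity for the module structure of `F_*^e R`. Both sides are additive in `a` and
in `f`, since `q`-th powers are additive in characteristic `p`, so monomials suffice. -/
theorem frobeniusCoords_pow_mul (a f : MvPolynomial (Fin n) k) :
    frobeniusCoords p e C (a ^ p ^ e * f) = a • frobeniusCoords p e C f := by
  have hq : 0 < p ^ e := pow_pos (Fact.out : p.Prime).pos _
  induction f using MvPolynomial.induction_on' with
  | add f g hf hg => rw [mul_add, map_add, hf, hg, map_add, smul_add]
  | monomial m c =>
    induction a using MvPolynomial.induction_on' with
    | add a b ha hb => rw [add_pow_expChar_pow, add_mul, map_add, ha, hb, add_smul]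
    | monomial l a =>
      have h1 : expDiv (p ^ e) (p ^ e • l + m) = l + expDiv (p ^ e) m := by
        ext i
        simp [Nat.mul_add_div hq]
      have h2 : expMod (p ^ e) (p ^ e • l + m) = expMod (p ^ e) m := by
        ext i
        simp
      rw [MvPolynomial.monomial_pow, MvPolynomial.monomial_mul, frobeniusCoords_monomial,
        frobeniusCoords_monomial, monomialCoords, monomialCoords, h1, h2, AddMonoidHom.comp_apply,
        AddMonoidHom.comp_apply, rootCoeffHom_pow_mul, Finsupp.liftAddHom_apply,
        Finsupp.liftAddHom_apply, Finsupp.sum_smul_index' (by simp), Finsupp.smul_sum]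
      refine Finsupp.sum_congr fun i _ => ?_
      simp [MvPolynomial.monomial_mul]

theorem frobeniusCoords_mem_of_mem_frobeniusPower {I : Ideal (MvPolynomial (Fin n) k)}
    {f : MvPolynomial (Fin n) k} (hf : f ∈ frobeniusPower (p ^ e) I) (b : ι × (Fin n →₀ ℕ)) :
    frobeniusCoords p e C f b ∈ I := by
  -- The coordinates are linear only over `q`-th powers, so the extra factor `r` is needed to absorb
  -- arbitrary multipliers in the span induction.
  suffices h : ∀ r, frobeniusCoords p e C (f * r) b ∈ I by simpa using h 1
  induction hf using Submodule.span_induction with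
  | mem x hx =>
    obtain ⟨a, ha, rfl⟩ := hx
    intro r
    simp only [frobeniusCoords_pow_mul p e C a r, Finsupp.smul_apply, smul_eq_mul]
    exact I.mul_mem_right _ ha
  | zero => simp
  | add x y _ _ hx hy =>
    intro r
    rw [add_mul, map_add]
    exact I.add_mem (hx r) (hy r)
  | smul s x _ hx =>
    intro r
    rw [smul_eq_mul, mul_comm s, mul_assoc]
    exact hx _

/-- Conversely, `f` is the sum of the `q`-th powers of its coordinates times basis elements. The
index set also contains exponents `≥ q`; the coordinates there vanish, so the test is unaffected. -/
theorem mem_frobeniusPower_iff {I : Ideal (MvPolynomial (Fin n) k)}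
    {f : MvPolynomial (Fin n) k} :
    f ∈ frobeniusPower (p ^ e) I ↔ ∀ b, frobeniusCoords p e C f b ∈ I := by
  refine ⟨frobeniusCoords_mem_of_mem_frobeniusPower p e C, fun h => ?_⟩
  rw [← ofFrobeniusCoords_frobeniusCoords p e C f, ofFrobeniusCoords, Finsupp.liftAddHom_apply]
  refine Ideal.sum_mem _ fun b _ => ?_
  exact Ideal.mul_mem_right _ _ (pow_mem_frobeniusPower (h b))

theorem traceMap_eq_frobeniusCoords (i₀ : ι) (f : MvPolynomial (Fin n) k) :
    traceMap p e C i₀ f =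
      frobeniusCoords p e C f (i₀, Finsupp.equivFunOnFinite.symm fun _ => p ^ e - 1) := by
  classical
  conv_rhs => rw [← f.support_sum_monomial_coeff, map_sum, Finsupp.finsetSum_apply]
  refine Finset.sum_congr rfl fun m _ => ?_
  rw [frobeniusCoords_monomial, monomialCoords, AddMonoidHom.comp_apply,
    Finsupp.liftAddHom_apply, Finsupp.sum, Finsupp.finsetSum_apply]
  split_ifs with h
  · have : expMod (p ^ e) m = Finsupp.equivFunOnFinite.symm fun _ => p ^ e - 1 := by
      ext i
      simp [h]
    rw [Finset.sum_eq_single i₀]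
    · simp [this]
    · intro i _ hi
      simp [hi]
    · intro hi
      simp only [Finsupp.mem_support_iff, not_not] at hi
      simp [hi]
  · refine (Finset.sum_eq_zero fun i _ => ?_).symm
    have : expMod (p ^ e) m ≠ Finsupp.equivFunOnFinite.symm fun _ => p ^ e - 1 := by
      rintro h'
      exact h fun i => by simpa using DFunLike.congr_fun h' i
    simp [this]

theorem traceMap_pow_mul (i₀ : ι) (a f : MvPolynomial (Fin n) k) :
    traceMap p e C i₀ (a ^ p ^ e * f) = a * traceMap p e C i₀ f := by
  simp [traceMap_eq_frobeniusCoords, frobeniusCoords_pow_mul]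

theorem sInf_frobeniusPower_le (S : Set (Ideal (MvPolynomial (Fin n) k))) :
    sInf (frobeniusPower (p ^ e) '' S) ≤ frobeniusPower (p ^ e) (sInf S) := by
  let C := Module.Free.chooseBasis (powersSubfield k p e) k
  intro f hf
  rw [mem_frobeniusPower_iff p e C]
  intro b
  rw [Submodule.mem_sInf] at hf ⊢
  exact fun J hJ => (mem_frobeniusPower_iff p e C).1 (hf _ ⟨J, hJ, rfl⟩) b

/-- A form of flatness of Frobenius: the coordinates of `s^q f` are `s` times those of `f`. -/
theorem mem_frobeniusPower_of_pow_mul_mem {I : Ideal (MvPolynomial (Fin n) k)}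
    {s f : MvPolynomial (Fin n) k} (hI : ∀ x, s * x ∈ I → x ∈ I)
    (h : s ^ p ^ e * f ∈ frobeniusPower (p ^ e) I) : f ∈ frobeniusPower (p ^ e) I := by
  let C := Module.Free.chooseBasis (powersSubfield k p e) k
  rw [mem_frobeniusPower_iff p e C] at h ⊢
  intro b
  have := h b
  rw [frobeniusCoords_pow_mul] at this
  exact hI _ this

end Coordinates

/-! ### `Ie`, star closures and colon ideals under localization. -/

section Localization

variable {k : Type*} [Field k] (p : ℕ) [Fact p.Prime] [CharP k p] (e : ℕ) {n : ℕ}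
  (𝔭 : Ideal (MvPolynomial (Fin n) k)) [𝔭.IsPrime]

theorem charP_localization : CharP (Localization.AtPrime 𝔭) p :=
  charP_of_injective_algebraMap (algebraMap k (Localization.AtPrime 𝔭)).injective p

theorem map_frobeniusPower_localization (I : Ideal (MvPolynomial (Fin n) k)) :
    (frobeniusPower (p ^ e) I).map (algebraMap _ (Localization.AtPrime 𝔭)) =
      frobeniusPower (p ^ e) (I.map (algebraMap _ (Localization.AtPrime 𝔭))) :=
  haveI := charP_localization p 𝔭
  map_frobeniusPower p e _ I

theorem comap_frobeniusPower_le (J : Ideal (Localization.AtPrime 𝔭)) :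
    (frobeniusPower (p ^ e) J).comap (algebraMap (MvPolynomial (Fin n) k) _) ≤
      frobeniusPower (p ^ e) (J.comap (algebraMap (MvPolynomial (Fin n) k) _)) := by
  intro x hx
  rw [Ideal.mem_comap] at hx
  nth_rw 1 [← IsLocalization.map_under 𝔭.primeCompl (Localization.AtPrime 𝔭) J] at hx
  rw [← map_frobeniusPower_localization,
    IsLocalization.algebraMap_mem_map_algebraMap_iff 𝔭.primeCompl] at hx
  obtain ⟨s, hs, hsx⟩ := hx
  refine mem_frobeniusPower_of_pow_mul_mem p e (s := s) (fun y hy => ?_) ?_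
  · rw [Ideal.mem_comap, map_mul] at hy
    exact (Ideal.unit_mul_mem_iff_mem _ (IsLocalization.map_units (Localization.AtPrime 𝔭)
      (⟨s, hs⟩ : 𝔭.primeCompl))).1 hy
  -- A denominator `s` is enlarged to the denominator `s^q`, whose root can be cancelled modulo the
  -- contracted ideal.
  · obtain ⟨m, hm⟩ := Nat.exists_eq_succ_of_ne_zero
      (pow_ne_zero e (Fact.out : p.Prime).ne_zero)
    rw [hm, pow_succ, mul_assoc]
    rw [hm] at hsx
    exact Ideal.mul_mem_left _ _ hsx

theorem le_frobeniusPower_Ie (A : Ideal (MvPolynomial (Fin n) k)) :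
    A ≤ frobeniusPower (p ^ e) (Ie (p ^ e) A) := by
  refine le_trans (le_sInf ?_) (sInf_frobeniusPower_le p e _)
  rintro _ ⟨J, hJ, rfl⟩
  exact hJ

theorem map_Ie (A : Ideal (MvPolynomial (Fin n) k)) :
    (Ie (p ^ e) A).map (algebraMap _ (Localization.AtPrime 𝔭)) =
      Ie (p ^ e) (A.map (algebraMap _ (Localization.AtPrime 𝔭))) := by
  apply le_antisymm
  · refine le_sInf fun J hJ => ?_
    rw [Ideal.map_le_iff_le_comap]
    exact sInf_le ((Ideal.map_le_iff_le_comap.1 hJ).trans (comap_frobeniusPower_le p e 𝔭 J))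
  · refine sInf_le ?_
    rw [Set.mem_ofPred_eq, ← map_frobeniusPower_localization]
    exact Ideal.map_mono (le_frobeniusPower_Ie p e A)

variable (u : MvPolynomial (Fin n) k)

theorem le_starClosure {R : Type*} [CommRing R] (q : ℕ) (u : R) (A : Ideal R) :
    A ≤ starClosure q u A :=
  le_sInf fun _ hB => hB.1

theorem span_mul_starClosure_le (A : Ideal (MvPolynomial (Fin n) k)) :
    Ideal.span {u} * starClosure (p ^ e) u A ≤ frobeniusPower (p ^ e) (starClosure (p ^ e) u A) := by
  refine le_trans (le_sInf ?_) (sInf_frobeniusPower_le p e _)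
  rintro _ ⟨B, hB, rfl⟩
  exact (Ideal.mul_mono_right (sInf_le hB)).trans hB.2

theorem map_starClosure (A : Ideal (MvPolynomial (Fin n) k)) :
    (starClosure (p ^ e) u A).map (algebraMap _ (Localization.AtPrime 𝔭)) =
      starClosure (p ^ e) (algebraMap _ (Localization.AtPrime 𝔭) u)
        (A.map (algebraMap _ (Localization.AtPrime 𝔭))) := by
  apply le_antisymm
  · refine le_sInf fun B hB => ?_
    rw [Ideal.map_le_iff_le_comap]
    refine sInf_le ⟨Ideal.map_le_iff_le_comap.1 hB.1, ?_⟩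
    refine le_trans ?_ (comap_frobeniusPower_le p e 𝔭 B)
    rw [← Ideal.map_le_iff_le_comap, Ideal.map_mul, Ideal.map_span, Set.image_singleton]
    exact (Ideal.mul_mono_right Ideal.map_comap_le).trans hB.2
  · refine sInf_le ⟨Ideal.map_mono (le_starClosure _ _ _), ?_⟩
    rw [← map_frobeniusPower_localization, ← Set.image_singleton, ← Ideal.map_span,
      ← Ideal.map_mul]
    exact Ideal.map_mono (span_mul_starClosure_le p e u A)

theorem map_colon {R S : Type*} [CommRing R] [CommRing S] [Algebra R S] (M : Submonoid R)
    [IsLocalization M S] (I J : Ideal R) (hJ : J.FG) :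
    (I.colon (J : Set R)).map (algebraMap R S) =
      (I.map (algebraMap R S)).colon (J.map (algebraMap R S) : Set S) := by
  apply le_antisymm
  · rw [Ideal.map_le_iff_le_comap]
    intro x hx
    rw [Ideal.mem_comap, Ideal.map, Ideal.map, Ideal.colon_span, Submodule.mem_colon]
    rintro _ ⟨y, hy, rfl⟩
    rw [smul_eq_mul, ← map_mul]
    exact Ideal.mem_map_of_mem _ (Submodule.mem_colon.1 hx y hy)
  · intro z hz
    obtain ⟨x, s, rfl⟩ := IsLocalization.exists_mk'_eq M z
    rw [IsLocalization.mk'_mem_iff] at hz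
    rw [IsLocalization.mk'_mem_map_algebraMap_iff M]
    have hx : ∀ y ∈ J, ∃ t ∈ M, t * (x * y) ∈ I := by
      intro y hy
      have := Submodule.mem_colon.1 hz _ (Ideal.mem_map_of_mem _ hy)
      rwa [smul_eq_mul, ← map_mul, IsLocalization.algebraMap_mem_map_algebraMap_iff M] at this
    classical
    obtain ⟨G, rfl⟩ := hJ
    choose! t ht h using hx
    -- Finitely many generators have a common denominator.
    refine ⟨∏ y ∈ G, t y, Submonoid.prod_mem _ fun y hy => ht y (Ideal.subset_span hy), ?_⟩
    rw [Ideal.colon_span, Submodule.mem_colon]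
    intro y hy
    rw [smul_eq_mul, mul_assoc, ← Finset.mul_prod_erase G t hy, mul_comm (t y), mul_assoc]
    exact Ideal.mul_mem_left _ _ (h y (Ideal.subset_span hy))

theorem map_colonIdeal (P : Ideal (MvPolynomial (Fin n) k)) :
    (colonIdeal (p ^ e) u P).map (algebraMap _ (Localization.AtPrime 𝔭)) =
      colonIdeal (p ^ e) (algebraMap _ (Localization.AtPrime 𝔭) u)
        (P.map (algebraMap _ (Localization.AtPrime 𝔭))) := by
  rw [colonIdeal, map_colon 𝔭.primeCompl _ _ (IsNoetherian.noetherian _),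
    map_colon 𝔭.primeCompl _ _ (IsNoetherian.noetherian _), Ideal.map_sup, Ideal.map_span,
    Set.image_singleton, map_frobeniusPower_localization, colonIdeal]

end Localization

/-! ### Termination and independence of choices. -/

section Algorithm

variable {R : Type*} [CommRing R] (q : ℕ) (u : R)

theorem le_colonIdeal (P : Ideal R) : P ≤ colonIdeal q u P := by
  intro x hx
  rw [colonIdeal, Submodule.mem_colon]
  intro r hr
  refine Ideal.mem_sup_right ?_
  have := Submodule.mem_colon.1 hr x hx
  rwa [smul_eq_mul, mul_comm] at this

theorem le_singularIdeal (P : Ideal R) : P ≤ singularIdeal P := by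
  intro x hx
  rw [singularIdeal, Ideal.mem_comap, Ideal.Quotient.eq_zero_iff_mem.2 hx]
  exact zero_mem _

variable {q u}

theorem le_of_mem_newPrimes {P Q : Ideal R} (h : Q ∈ newPrimes q u P) : P ≤ Q := by
  rcases h with h | h
  · exact (le_singularIdeal P).trans ((le_starClosure q u _).trans h.1.2)
  · exact (le_colonIdeal q u P).trans ((le_starClosure q u _).trans h.1.2)

theorem isPrime_of_mem_newPrimes {P Q : Ideal R} (h : Q ∈ newPrimes q u P) : Q.IsPrime := by
  rcases h with h | h
  · exact h.1.1
  · exact h.1.1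

theorem finite_newPrimes [IsNoetherianRing R] (P : Ideal R) : (newPrimes q u P).Finite :=
  (Ideal.finite_minimalPrimes_of_isNoetherianRing R _).union
    (Ideal.finite_minimalPrimes_of_isNoetherianRing R _)

variable (q u)

/-- The ideals that are obtained from `P` by repeatedly passing to new primes. -/
def descendants (P : Ideal R) : Set (Ideal R) :=
  {Q | Relation.ReflTransGen (fun P Q => Q ∈ newPrimes q u P) P Q}

theorem isPrime_of_mem_descendants {P Q : Ideal R} (hP : P.IsPrime)
    (h : Q ∈ descendants q u P) : Q.IsPrime := by
  induction h with
  | refl => exact hP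
  | tail _ h _ => exact isPrime_of_mem_newPrimes h

/-- `P` may be among its own new primes, so a chain can stay at `P` for a while; only its first
strict increase matters. -/
theorem descendants_subset (P : Ideal R) :
    descendants q u P ⊆ {P} ∪ ⋃ Q ∈ {Q ∈ newPrimes q u P | P < Q}, descendants q u Q := by
  intro Q hQ
  suffices h : ∀ X, Relation.ReflTransGen (fun P Q => Q ∈ newPrimes q u P) X Q → X = P →
      Q ∈ {P} ∪ ⋃ Q ∈ {Q ∈ newPrimes q u P | P < Q}, descendants q u Q from h P hQ rfl
  intro X hX
  induction hX using Relation.ReflTransGen.head_induction_on with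
  | refl => exact fun h => Or.inl h
  | @head X Y hXY hYQ ih =>
    rintro rfl
    rcases (le_of_mem_newPrimes hXY).eq_or_lt with h | h
    · exact ih h.symm
    · exact Or.inr (Set.mem_biUnion (show Y ∈ {Q ∈ newPrimes q u X | X < Q} from ⟨hXY, h⟩) hYQ)

theorem finite_descendants [IsNoetherianRing R] (P : Ideal R) : (descendants q u P).Finite := by
  induction P using WellFoundedGT.induction with
  | ind P ih =>
    refine Set.Finite.subset ((Set.finite_singleton P).union ?_) (descendants_subset q u P)
    exact ((finite_newPrimes P).subset (Set.sep_subset _ _)).biUnion fun Q hQ => ih Q hQ.2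

variable {q u}

/-- Loop invariant: the found primes are descendants of `0`, and they include the new primes of
every treated prime. When the two lists agree, the list is closed under passing to new primes. -/
theorem IsOutput.eq_descendants {A : Set (Ideal R)} (h : IsOutput q u A) :
    A = descendants q u ⊥ := by
  have key : ∀ s : State R, Relation.ReflTransGen (Step q u) ⟨{⊥}, ∅⟩ s →
      ⊥ ∈ s.found ∧ s.found ⊆ descendants q u ⊥ ∧ ∀ P ∈ s.done, newPrimes q u P ⊆ s.found := by
    intro s hs
    induction hs with
    | refl =>
      refine ⟨rfl, ?_, fun P hP => hP.elim⟩
      rintro _ rfl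
      exact Relation.ReflTransGen.refl
    | tail _ h ih =>
      cases h with
      | pass F D P hF hD =>
        obtain ⟨h1, h2, h3⟩ := ih
        refine ⟨Or.inl h1, Set.union_subset h2 fun Q hQ => (h2 hF).tail hQ, ?_⟩
        rintro Q (rfl | hQ)
        · exact Set.subset_union_right
        · exact (h3 Q hQ).trans Set.subset_union_left
  obtain ⟨h1, h2, h3⟩ := key _ h
  refine h2.antisymm fun Q hQ => ?_
  induction hQ with
  | refl => exact h1
  | tail _ h ih => exact h3 _ ih h

/-- The number of descendants of `0` not yet treated drops with each pass. -/
theorem exists_isOutput [IsNoetherianRing R] (q : ℕ) (u : R) :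
    ∃ A : Set (Ideal R), IsOutput q u A := by
  have key : ∀ (m : ℕ) (F D : Set (Ideal R)), D ⊆ F → F ⊆ descendants q u ⊥ →
      (descendants q u ⊥ \ D).ncard = m →
      ∃ A : Set (Ideal R), Relation.ReflTransGen (Step q u) ⟨F, D⟩ ⟨A, A⟩ := by
    intro m
    induction m using Nat.strong_induction_on with
    | _ m ih =>
      intro F D hDF hF hm
      rcases hDF.eq_or_ssubset with rfl | h
      · exact ⟨D, .refl⟩
      · obtain ⟨P, hPF, hPD⟩ := Set.exists_of_ssubset h
        obtain ⟨A, hA⟩ := ih _ (by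
          rw [← hm]
          refine Set.ncard_lt_ncard ?_ ((finite_descendants q u ⊥).subset Set.sdiff_subset)
          exact (Set.ssubset_iff_of_subset
            (Set.sdiff_subset_sdiff_right (Set.subset_insert P D))).2
            ⟨P, ⟨hF hPF, hPD⟩, fun h => h.2 (Set.mem_insert _ _)⟩)
          (F ∪ newPrimes q u P) (insert P D)
          (Set.insert_subset (Or.inl hPF) (hDF.trans Set.subset_union_left))
          (Set.union_subset hF fun Q hQ => (hF hPF).tail hQ) rfl
        exact ⟨A, .head (.pass F D P hPF hPD) hA⟩
  refine key _ _ _ (Set.empty_subset _) ?_ rfl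
  rintro _ rfl
  exact Relation.ReflTransGen.refl

theorem isOutput_iff [IsNoetherianRing R] {A : Set (Ideal R)} :
    IsOutput q u A ↔ A = descendants q u ⊥ := by
  refine ⟨IsOutput.eq_descendants, ?_⟩
  rintro rfl
  obtain ⟨A, hA⟩ := exists_isOutput q u
  rwa [← hA.eq_descendants]

end Algorithm

/-! ### Primes of `R_𝔭` and primes of `R` inside `𝔭`. -/

section Extensions

variable {R : Type*} [CommRing R] (𝔭 : Ideal R) [𝔭.IsPrime]

theorem comap_map_of_le {P : Ideal R} (hP : P.IsPrime) (h : P ≤ 𝔭) :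
    (P.map (algebraMap R (Localization.AtPrime 𝔭))).comap (algebraMap R _) = P :=
  IsLocalization.under_map_of_isPrime_disjoint 𝔭.primeCompl _ hP
    (Set.disjoint_left.2 fun _ hx hx' => hx (h hx'))

theorem isPrime_map_of_le {P : Ideal R} (hP : P.IsPrime) (h : P ≤ 𝔭) :
    (P.map (algebraMap R (Localization.AtPrime 𝔭))).IsPrime :=
  IsLocalization.isPrime_of_isPrime_disjoint 𝔭.primeCompl _ P hP
    (Set.disjoint_left.2 fun _ hx hx' => hx (h hx'))

theorem comap_le_of_isPrime {Q : Ideal (Localization.AtPrime 𝔭)} (hQ : Q.IsPrime) :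
    Q.comap (algebraMap R _) ≤ 𝔭 := by
  have := ((IsLocalization.isPrime_iff_isPrime_disjoint 𝔭.primeCompl _ Q).1 hQ).2
  intro x hx
  by_contra h
  exact Set.disjoint_left.1 this h hx

theorem map_comap_localization (Q : Ideal (Localization.AtPrime 𝔭)) :
    (Q.comap (algebraMap R _)).map (algebraMap R _) = Q :=
  IsLocalization.map_under 𝔭.primeCompl _ Q

theorem extensions_minimalPrimes (J : Ideal R) :
    extensions 𝔭 J.minimalPrimes =
      (J.map (algebraMap R (Localization.AtPrime 𝔭))).minimalPrimes := by
  rw [IsLocalization.minimalPrimes_map 𝔭.primeCompl]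
  ext Q
  constructor
  · rintro ⟨P, hP, hP𝔭, rfl⟩
    rw [Set.mem_preimage, Ideal.under_def, comap_map_of_le 𝔭 hP.1.1 hP𝔭]
    exact hP
  · intro hQ
    have hQ' : (Q.comap (algebraMap R _)).IsPrime := hQ.1.1
    refine ⟨_, hQ, ?_, (map_comap_localization 𝔭 Q).symm⟩
    intro x hx
    by_contra h
    refine hQ'.ne_top ((Ideal.comap_eq_top_iff).2 (Ideal.eq_top_of_isUnit_mem _ hx ?_))
    exact IsLocalization.map_units (Localization.AtPrime 𝔭) (⟨x, h⟩ : 𝔭.primeCompl)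

theorem extensions_union (X Y : Set (Ideal R)) :
    extensions 𝔭 (X ∪ Y) = extensions 𝔭 X ∪ extensions 𝔭 Y := by
  ext Q
  constructor
  · rintro ⟨P, hP | hP, h⟩
    · exact Or.inl ⟨P, hP, h⟩
    · exact Or.inr ⟨P, hP, h⟩
  · rintro (⟨P, hP, h⟩ | ⟨P, hP, h⟩)
    · exact ⟨P, Or.inl hP, h⟩
    · exact ⟨P, Or.inr hP, h⟩

/-- Chains are transported link by link. Since primes only grow along a chain, all members lie in
`𝔭` once the last does, so the hypothesis applies to each link. -/
theorem extensions_descendants [IsDomain R] (q : ℕ) (u : R)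
    (h : ∀ P : Ideal R, P.IsPrime → P ≤ 𝔭 → extensions 𝔭 (newPrimes q u P) =
      newPrimes q (algebraMap R (Localization.AtPrime 𝔭) u)
        (P.map (algebraMap R (Localization.AtPrime 𝔭)))) :
    extensions 𝔭 (descendants q u ⊥) =
      descendants q (algebraMap R (Localization.AtPrime 𝔭) u) ⊥ := by
  ext Q
  constructor
  · rintro ⟨P, hP, hP𝔭, rfl⟩
    induction hP with
    | refl => rw [Ideal.map_bot]; exact Relation.ReflTransGen.refl
    | @tail P P' hP hPP' ih =>
      have hle : P ≤ 𝔭 := (le_of_mem_newPrimes hPP').trans hP𝔭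
      refine (ih hle).tail ?_
      rw [← h P (isPrime_of_mem_descendants q u Ideal.isPrime_bot hP) hle]
      exact ⟨P', hPP', hP𝔭, rfl⟩
  · intro hQ
    induction hQ with
    | refl => exact ⟨⊥, Relation.ReflTransGen.refl, bot_le, Ideal.map_bot.symm⟩
    | tail _ hQQ' ih =>
      obtain ⟨P, hP, hP𝔭, rfl⟩ := ih
      rw [← h P (isPrime_of_mem_descendants q u Ideal.isPrime_bot hP) hP𝔭] at hQQ'
      obtain ⟨P', hP', hP'𝔭, rfl⟩ := hQQ'
      exact ⟨P', hP.tail hP', hP'𝔭, rfl⟩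

theorem extensions_sep_not_le {X : Set (Ideal R)} (hX : ∀ P ∈ X, P.IsPrime) (J : Ideal R) :
    {Q ∈ extensions 𝔭 X | ¬ J.map (algebraMap R (Localization.AtPrime 𝔭)) ≤ Q} =
      extensions 𝔭 {P ∈ X | ¬ J ≤ P} := by
  ext Q
  constructor
  · rintro ⟨⟨P, hP, hP𝔭, rfl⟩, hJ⟩
    exact ⟨P, ⟨hP, fun h => hJ (Ideal.map_mono h)⟩, hP𝔭, rfl⟩
  · rintro ⟨P, ⟨hP, hJ⟩, hP𝔭, rfl⟩
    refine ⟨⟨P, hP, hP𝔭, rfl⟩, fun h => hJ ?_⟩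
    rwa [Ideal.map_le_iff_le_comap, comap_map_of_le 𝔭 (hX P hP) hP𝔭] at h

end Extensions

/-! ### Regular local rings and their regular quotients. -/

section RegularLocal

open IsLocalRing

variable {R : Type*} [CommRing R]

theorem exists_ringKrullDim_eq_natCast (R : Type*) [CommRing R] [IsLocalRing R]
    [IsNoetherianRing R] :
    ∃ d : ℕ, ringKrullDim R = d := by
  have h1 : ringKrullDim R ≠ ⊤ := ringKrullDim_ne_top
  have h2 : ringKrullDim R ≠ ⊥ := ringKrullDim_ne_bot
  obtain ⟨a, ha⟩ := WithBot.ne_bot_iff_exists.1 h2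
  rw [← ha] at h1 ⊢
  obtain ⟨b, rfl⟩ := ENat.ne_top_iff_exists.1 (fun h : a = ⊤ => h1 (by rw [h]; rfl))
  exact ⟨b, rfl⟩

theorem span_coe_image_eq_maximalIdeal [IsLocalRing R] {s : Set (maximalIdeal R)}
    (hs : Submodule.span R s = ⊤) :
    Ideal.span (Subtype.val '' s) = maximalIdeal R := by
  have := congrArg (Submodule.map (maximalIdeal R).subtype) hs
  rwa [Submodule.map_span, Submodule.map_top, Submodule.range_subtype] at this

/-- Extend the classes of the `f i` to a basis of the cotangent space and lift it; by Nakayama the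
lifts generate the maximal ideal. So the quotient has embedding dimension at most `dim R - |ι|`,
while its Krull dimension is at least that. -/
theorem isRegularLocalRing_quotient_span [IsRegularLocalRing R] {ι : Type*} [Fintype ι]
    (f : ι → maximalIdeal R)
    (hf : LinearIndependent (ResidueField R) fun i => (maximalIdeal R).toCotangent (f i)) :
    IsRegularLocalRing (R ⧸ Ideal.span (Set.range fun i => (f i : R))) ∧
      ringKrullDim (R ⧸ Ideal.span (Set.range fun i => (f i : R))) + Fintype.card ι =
        ringKrullDim R := by
  set v : ι → CotangentSpace R := fun i => (maximalIdeal R).toCotangent (f i) with hv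
  set I := Ideal.span (Set.range fun i => (f i : R)) with hI
  have hIm : I ≤ maximalIdeal R := by
    rw [hI, Ideal.span_le]
    rintro _ ⟨i, rfl⟩
    exact (f i).2
  have hItop : I ≠ ⊤ := fun h => (maximalIdeal.isMaximal R).ne_top (top_le_iff.1 (h ▸ hIm))
  have : Nontrivial (R ⧸ I) := Ideal.Quotient.nontrivial_iff.2 hItop
  have : IsLocalRing (R ⧸ I) := IsLocalRing.of_surjective' _ Ideal.Quotient.mk_surjective
  let b := Module.Basis.extend hf.linearIndepOn_id
  set B := hf.linearIndepOn_id.extend (Set.subset_univ _) with hB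
  have hvB : Set.range v ⊆ B := hf.linearIndepOn_id.subset_extend _
  have hspanB : Submodule.span (ResidueField R) B = ⊤ := by
    rw [hB, hf.linearIndepOn_id.span_extend_eq_span, Submodule.span_univ]
  have hBfin : B.Finite := (Module.Finite.finite_basis b : Finite B)
  have hcard : B.ncard = Module.finrank (ResidueField R) (CotangentSpace R) :=
    (Module.finrank_eq_nat_card_basis b).symm
  have hvcard : (Set.range v).ncard = Fintype.card ι := by
    rw [← Nat.card_eq_fintype_card, ← Nat.card_coe_set_eq,
      Nat.card_congr (Equiv.ofInjective v hf.injective)]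
  let g := Function.surjInv (maximalIdeal R).toCotangent_surjective
  set G := g '' (B \ Set.range v) with hG
  have hGfin : G.Finite := hBfin.sdiff.image _
  have hGcard : G.ncard + Fintype.card ι ≤ B.ncard := by
    rw [← hvcard, ← Set.ncard_sdiff_add_ncard_of_subset hvB hBfin]
    exact Nat.add_le_add_right (Set.ncard_image_le hBfin.sdiff) _
  have hspan : Submodule.span R (Set.range f ∪ G) = ⊤ := by
    rw [← CotangentSpace.span_image_eq_top_iff, ← top_le_iff, ← hspanB]
    refine Submodule.span_mono fun x hx => ?_
    by_cases h : x ∈ Set.range v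
    · obtain ⟨i, rfl⟩ := h
      exact ⟨f i, Or.inl ⟨i, rfl⟩, rfl⟩
    · exact ⟨g x, Or.inr ⟨x, ⟨hx, h⟩, rfl⟩, Function.surjInv_eq _ x⟩
  have hmax : maximalIdeal (R ⧸ I) =
      Ideal.span (Ideal.Quotient.mk I '' (Subtype.val '' G)) := by
    rw [← IsLocalRing.map_maximalIdeal_of_surjective _ Ideal.Quotient.mk_surjective,
      ← congrArg (Ideal.map (Ideal.Quotient.mk I)) (span_coe_image_eq_maximalIdeal hspan),
      Ideal.map_span, Set.image_union, Set.image_union, Ideal.span_union, sup_eq_right,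
      Ideal.span_le]
    rintro _ ⟨_, ⟨_, ⟨i, rfl⟩, rfl⟩, rfl⟩
    rw [Ideal.Quotient.eq_zero_iff_mem.2 (Ideal.subset_span (Set.mem_range_self i))]
    exact zero_mem _
  have h1 : (maximalIdeal (R ⧸ I)).spanFinrank ≤ G.ncard := by
    rw [hmax]
    refine (Submodule.spanFinrank_span_le_ncard_of_finite ((hGfin.image _).image _)).trans ?_
    exact (Set.ncard_image_le (hGfin.image _)).trans (Set.ncard_image_le hGfin)
  have h2 : I.spanFinrank ≤ Fintype.card ι := by
    refine (Submodule.spanFinrank_span_le_ncard_of_finite (Set.finite_range _)).trans ?_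
    rw [← Set.image_univ, ← Nat.card_eq_fintype_card, ← Set.ncard_univ]
    exact Set.ncard_image_le Set.finite_univ
  have h3 := ringKrullDim_le_ringKrullDim_quotient_add_spanFinrank I
    (by rwa [IsLocalRing.ringJacobson_eq_maximalIdeal])
  have h4 := ringKrullDim_le_spanFinrank_maximalIdeal (R ⧸ I)
  have h5 := (IsRegularLocalRing.iff_finrank_cotangentSpace (R := R)).1 inferInstance
  obtain ⟨d', hd'⟩ := exists_ringKrullDim_eq_natCast (R ⧸ I)
  rw [← h5, hd'] at h3
  rw [hd'] at h4
  norm_cast at h3 h4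
  constructor
  · apply IsRegularLocalRing.of_spanFinrank_maximalIdeal_le
    rw [hd']
    norm_cast
    omega
  · rw [hd', ← h5]
    norm_cast
    omega

/-- Induction on the dimension. Prime avoidance gives `x` in the maximal ideal, outside its square
and all minimal primes. Then `R/(x)` is regular of smaller dimension, so `(x)` is prime and contains
a minimal prime `P`. As `x ∉ P`, `P = xP`, and Nakayama gives `P = 0`. -/
theorem isDomain_of_isRegularLocalRing [IsRegularLocalRing R] : IsDomain R := by
  obtain ⟨d, hd⟩ := exists_ringKrullDim_eq_natCast R
  induction d generalizing R with
  | zero =>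
    have h := IsRegularLocalRing.spanFinrank_maximalIdeal (R := R)
    rw [hd, Nat.cast_inj,
      Submodule.spanFinrank_eq_zero_iff_eq_bot (IsNoetherian.noetherian _)] at h
    exact (IsLocalRing.isField_iff_maximalIdeal_eq.2 h).isDomain
  | succ d ih =>
    have hm2 : ¬ maximalIdeal R ≤ maximalIdeal R ^ 2 := by
      intro h
      have h0 : maximalIdeal R = ⊥ := by
        refine Submodule.eq_bot_of_le_smul_of_le_jacobson_bot (maximalIdeal R) _
          (IsNoetherian.noetherian _) ?_ (IsLocalRing.maximalIdeal_le_jacobson _)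
        rwa [smul_eq_mul, ← pow_two]
      have h := IsRegularLocalRing.spanFinrank_maximalIdeal (R := R)
      rw [hd, Nat.cast_inj, h0] at h
      simp at h
    have hmin : ∀ P ∈ minimalPrimes R, ¬ maximalIdeal R ≤ P := by
      intro P hP h
      have hP' : P.IsPrime := hP.1.1
      have : ringKrullDim R = 0 := by
        have hPm : P = maximalIdeal R := le_antisymm (IsLocalRing.le_maximalIdeal hP'.ne_top) h
        rw [← maximalIdeal_height_eq_ringKrullDim, Ideal.height_eq_zero_iff.2 (hPm ▸ hP)]
        rfl
      rw [hd] at this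
      norm_cast at this
    classical
    have hfin := minimalPrimes.finite_of_isNoetherianRing R
    obtain ⟨x, hxm, hx⟩ : ∃ x ∈ maximalIdeal R,
        x ∉ ⋃ P ∈ (↑(insert (maximalIdeal R ^ 2) hfin.toFinset) : Set (Ideal R)), (P : Set R) := by
      by_contra! h
      -- Prime avoidance tolerates two ideals that need not be prime; both slots are given to the
      -- square of the maximal ideal.
      obtain ⟨P, hP, hle⟩ := (Ideal.subset_union_prime (f := id) (maximalIdeal R ^ 2)
        (maximalIdeal R ^ 2) (fun P hP h _ => by
          rw [Finset.mem_insert, Set.Finite.mem_toFinset] at hP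
          exact (hP.resolve_left h).1.1)).1 h
      rw [Finset.mem_insert, Set.Finite.mem_toFinset] at hP
      rcases hP with rfl | hP
      · exact hm2 hle
      · exact hmin P hP hle
    have hx2 : x ∉ maximalIdeal R ^ 2 := fun h => hx (Set.mem_biUnion (by simp) h)
    have hxP : ∀ P ∈ minimalPrimes R, x ∉ P := fun P hP h =>
      hx (Set.mem_biUnion (by simp [hP]) h)
    obtain ⟨hreg, hdim⟩ := isRegularLocalRing_quotient_span (fun _ : Unit => (⟨x, hxm⟩ : maximalIdeal R))
      (by
        rw [linearIndependent_unique_iff]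
        simpa [Ideal.toCotangent_eq_zero] using hx2)
    have hr : (Set.range fun _ : Unit => x) = {x} := Set.range_const
    rw [hr] at hreg hdim
    have hdom : IsDomain (R ⧸ Ideal.span {x}) := by
      apply ih
      obtain ⟨d', hd'⟩ := exists_ringKrullDim_eq_natCast (R ⧸ Ideal.span {x})
      rw [hd', hd] at hdim
      rw [hd']
      norm_cast at hdim ⊢
      simpa using hdim
    have hprime : (Ideal.span {x}).IsPrime := (Ideal.Quotient.isDomain_iff_prime _).1 hdom
    obtain ⟨P, hP, hPx⟩ := Ideal.exists_minimalPrimes_le (J := Ideal.span {x}) (bot_le (a := _))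
    have hPp : P.IsPrime := hP.1.1
    have hP0 : P = ⊥ := by
      refine Submodule.eq_bot_of_le_smul_of_le_jacobson_bot (Ideal.span {x}) _
        (IsNoetherian.noetherian _) ?_ ?_
      · intro y hy
        obtain ⟨a, rfl⟩ := Ideal.mem_span_singleton'.1 (hPx hy)
        rw [smul_eq_mul, mul_comm a]
        exact Ideal.mul_mem_mul (Ideal.mem_span_singleton_self x)
          ((hPp.mem_or_mem hy).resolve_right (hxP P hP))
      · rw [Ideal.span_singleton_le_iff_mem]
        exact IsLocalRing.maximalIdeal_le_jacobson _ hxm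
    subst hP0
    exact (IsDomain.of_bot_isPrime R)

/-- Lifts of minimal generators of the maximal ideal of `R/P`, together with the `g i`, generate
that of `R`. Both rings are regular, so counting generators compares dimensions. -/
theorem ringKrullDim_add_card_ge [IsRegularLocalRing R] (P : Ideal R)
    [hP : IsRegularLocalRing (R ⧸ P)] {ι : Type*} [Fintype ι] (g : ι → maximalIdeal R)
    (hg : ∀ x : maximalIdeal R, (x : R) ∈ P → (maximalIdeal R).toCotangent x ∈
      Submodule.span (ResidueField R) (Set.range fun i => (maximalIdeal R).toCotangent (g i))) :
    ringKrullDim R ≤ ringKrullDim (R ⧸ P) + Fintype.card ι := by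
  have hPm : P ≤ maximalIdeal R :=
    IsLocalRing.le_maximalIdeal (Ideal.Quotient.nontrivial_iff.1 inferInstance)
  have hfg : (maximalIdeal (R ⧸ P)).FG := IsNoetherian.noetherian _
  set S := (maximalIdeal (R ⧸ P)).generators with hS
  have hSfin : S.Finite := Submodule.FG.finite_generators hfg
  have hSspan : Ideal.span S = maximalIdeal (R ⧸ P) := Submodule.span_generators _
  have hlift : ∀ y : R ⧸ P, ∃ x : maximalIdeal R, y ∈ S → Ideal.Quotient.mk P x = y := by
    intro y
    by_cases hy : y ∈ S
    · obtain ⟨x, rfl⟩ := Ideal.Quotient.mk_surjective y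
      refine ⟨⟨x, ?_⟩, fun _ => rfl⟩
      have hxm : Ideal.Quotient.mk P x ∈ maximalIdeal (R ⧸ P) := hSspan ▸ Ideal.subset_span hy
      exact (IsLocalRing.mem_maximalIdeal x).2 fun hx => hxm (hx.map _)
    · exact ⟨0, fun h => (hy h).elim⟩
  choose l hl using hlift
  set T := l '' S with hT
  have hTfin : T.Finite := hSfin.image _
  have hmle : maximalIdeal R ≤ Ideal.span (Subtype.val '' T) ⊔ P := by
    have h1 : (Ideal.span (Subtype.val '' T)).map (Ideal.Quotient.mk P) =
        maximalIdeal (R ⧸ P) := by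
      rw [Ideal.map_span, ← hSspan, hT, Set.image_image, Set.image_image]
      congr 1
      ext y
      constructor
      · rintro ⟨z, hz, rfl⟩
        simpa only [hl z hz] using hz
      · exact fun hy => ⟨y, hy, hl y hy⟩
    have h2 := Ideal.comap_map_of_surjective (Ideal.Quotient.mk P) Ideal.Quotient.mk_surjective
      (Ideal.span (Subtype.val '' T))
    rw [← RingHom.ker_eq_comap_bot, Ideal.mk_ker, h1] at h2
    rw [← h2]
    intro x hx
    rw [Ideal.mem_comap, ← IsLocalRing.map_maximalIdeal_of_surjective _
      Ideal.Quotient.mk_surjective]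
    exact Ideal.mem_map_of_mem _ hx
  have hspan : Submodule.span R (T ∪ Set.range g) = ⊤ := by
    rw [← CotangentSpace.span_image_eq_top_iff, ← top_le_iff]
    rintro z -
    obtain ⟨x, rfl⟩ := (maximalIdeal R).toCotangent_surjective z
    obtain ⟨a, ha, c, hc, hac⟩ := Submodule.mem_sup.1 (hmle x.2)
    obtain ⟨a', ha', rfl⟩ : ∃ a' ∈ Submodule.span R T, (a' : R) = a := by
      have : Ideal.span (Subtype.val '' T) =
          (Submodule.span R T).map (maximalIdeal R).subtype := by
        rw [Submodule.map_span]; rfl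
      rw [this] at ha
      exact ha
    have hx : x = a' + ⟨c, hPm hc⟩ := Subtype.ext hac.symm
    rw [hx, map_add]
    refine add_mem ?_ ?_
    · have h1 : (maximalIdeal R).toCotangent a' ∈
          Submodule.span R ((maximalIdeal R).toCotangent '' T) := by
        rw [← Submodule.map_span]
        exact Submodule.mem_map_of_mem ha'
      exact Submodule.span_mono (Set.image_mono Set.subset_union_left)
        (Submodule.span_le_restrictScalars R (ResidueField R) _ h1)
    · refine Submodule.span_mono ?_ (hg ⟨c, hPm hc⟩ hc)
      rintro _ ⟨i, rfl⟩
      exact ⟨g i, Or.inr ⟨i, rfl⟩, rfl⟩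
  have hrank : (maximalIdeal R).spanFinrank ≤
      (maximalIdeal (R ⧸ P)).spanFinrank + Fintype.card ι := by
    have hfin : (T ∪ Set.range g).Finite := hTfin.union (Set.finite_range _)
    calc (maximalIdeal R).spanFinrank
        = (Ideal.span (Subtype.val '' (T ∪ Set.range g))).spanFinrank := by
          rw [span_coe_image_eq_maximalIdeal hspan]
      _ ≤ (Subtype.val '' (T ∪ Set.range g)).ncard :=
          Submodule.spanFinrank_span_le_ncard_of_finite (hfin.image _)
      _ ≤ (T ∪ Set.range g).ncard := Set.ncard_image_le hfin
      _ ≤ T.ncard + (Set.range g).ncard := Set.ncard_union_le _ _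
      _ ≤ _ := by
        refine add_le_add ?_ ?_
        · rw [← Submodule.FG.generators_ncard hfg]
          exact Set.ncard_image_le hSfin
        · rw [← Set.image_univ, ← Nat.card_eq_fintype_card, ← Set.ncard_univ]
          exact Set.ncard_image_le Set.finite_univ
  rw [← IsRegularLocalRing.spanFinrank_maximalIdeal (R := R),
    ← IsRegularLocalRing.spanFinrank_maximalIdeal (R := R ⧸ P)]
  exact_mod_cast hrank

/-- Take elements of `P` whose classes form a basis of the image of `P` in the cotangent space, and
let `I` be their span. Then `R/I` is a domain of dimension at most that of its quotient `R/P`; a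
proper quotient of it would have smaller dimension, so `I = P`. -/
theorem exists_linearIndependent_span_eq [IsRegularLocalRing R] (P : Ideal R)
    [hP : IsRegularLocalRing (R ⧸ P)] :
    ∃ (s : ℕ) (f : Fin s → maximalIdeal R),
      LinearIndependent (ResidueField R) (fun i => (maximalIdeal R).toCotangent (f i)) ∧
      Ideal.span (Set.range fun i => (f i : R)) = P := by
  have hPtop : P ≠ ⊤ := Ideal.Quotient.nontrivial_iff.1 inferInstance
  let W : Set (CotangentSpace R) :=
    (maximalIdeal R).toCotangent '' {x | (x : R) ∈ P}
  obtain ⟨b, hbW, hbspan, hbli⟩ := exists_linearIndependent (ResidueField R) W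
  have hbfin : b.Finite := hbli.finite
  have : Fintype b := hbfin.fintype
  choose g hgP hg using fun x : b => hbW x.2
  have hli : LinearIndependent (ResidueField R) fun x : b => (maximalIdeal R).toCotangent (g x) := by
    simpa only [hg] using hbli
  obtain ⟨hreg, hdim⟩ := isRegularLocalRing_quotient_span g hli
  set I := Ideal.span (Set.range fun i => (g i : R)) with hI
  have hIP : I ≤ P := by
    rw [hI, Ideal.span_le]
    rintro _ ⟨x, rfl⟩
    exact hgP x
  have hdimP := ringKrullDim_add_card_ge P g fun x hx => by
    have : (maximalIdeal R).toCotangent x ∈ Submodule.span (ResidueField R) b :=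
      hbspan ▸ Submodule.subset_span ⟨x, hx, rfl⟩
    have hrange : (Set.range fun i => (maximalIdeal R).toCotangent (g i)) = b := by
      simp only [hg, Subtype.range_coe_subtype, Set.ofPred_mem_eq]
    rwa [hrange]
  have key : I = P := by
    by_contra hne
    obtain ⟨x, hxP, hxI⟩ := SetLike.exists_of_lt (lt_of_le_of_ne hIP hne)
    have := isDomain_of_isRegularLocalRing (R := R ⧸ I)
    have h1 := ringKrullDim_succ_le_of_surjective (Ideal.Quotient.factor hIP)
      (Ideal.Quotient.factor_surjective hIP) (r := Ideal.Quotient.mk I x)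
      (mem_nonZeroDivisors_of_ne_zero fun h => hxI (Ideal.Quotient.eq_zero_iff_mem.1 h))
      (by rw [Ideal.Quotient.factor_mk]; exact Ideal.Quotient.eq_zero_iff_mem.2 hxP)
    obtain ⟨a, ha⟩ := exists_ringKrullDim_eq_natCast (R ⧸ P)
    obtain ⟨c, hc⟩ := exists_ringKrullDim_eq_natCast (R ⧸ I)
    rw [← hdim, ha, hc] at hdimP
    rw [ha, hc] at h1
    norm_cast at hdimP h1
    omega
  refine ⟨Fintype.card b, g ∘ (Fintype.equivFin b).symm, hli.comp _ (Equiv.injective _), ?_⟩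
  rw [← key, hI]
  congr 1
  exact (Fintype.equivFin b).symm.surjective.range_comp (fun i => (g i : R))

end RegularLocal

/-! ### Fields of characteristic `p` are formally smooth over `F_p`. -/

section Section

open Polynomial

variable {E L : Type*} [CommRing E] [Field L]

/-- The image `K` of `S` is a field containing all `p`-th powers, so `X^p - b^p` is the minimal
polynomial of `b` over `K`. Adjoin a lift `t` of `b` to `S`: each element is a polynomial in `t` of
degree `< p`, and if it maps to `0` its coefficients vanish. -/
theorem exists_subring_lt (p : ℕ) [Fact p.Prime] [CharP L p] (π : E →+* L)
    (hπ : Function.Surjective π) (S : Subring E)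
    (hS : ∀ x, x ^ p ∈ S) (hinj : ∀ x ∈ S, π x = 0 → x = 0) (b : L) (hb : b ∉ S.map π) :
    ∃ S' : Subring E, S < S' ∧ ∀ x ∈ S', π x = 0 → x = 0 := by
  have hp : p.Prime := Fact.out
  let K : Subfield L :=
    { S.map π with
      inv_mem' := by
        rintro _ ⟨s, hs, rfl⟩
        obtain ⟨t, ht⟩ := hπ (π s)⁻¹
        -- The lift `t` of the inverse need not lie in `S`, but `t^p` does, and `y⁻¹ = y^(-p)
        -- y^(p-1)`.
        refine ⟨t ^ p * s ^ (p - 1), S.mul_mem (hS t) (S.pow_mem hs _), ?_⟩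
        rw [map_mul, map_pow, map_pow, ht]
        by_cases h0 : π s = 0
        · simp [h0, hp.ne_zero]
        · obtain ⟨m, hm⟩ := Nat.exists_eq_succ_of_ne_zero hp.ne_zero
          rw [hm, Nat.succ_sub_one, pow_succ, mul_right_comm, ← mul_pow, inv_mul_cancel₀ h0,
            one_pow, one_mul] }
  have hbK : b ∉ K := hb
  let φ : S →+* K := (π.comp S.subtype).codRestrict K fun s => ⟨s, s.2, rfl⟩
  have hφ : Function.Injective φ := by
    rw [injective_iff_map_eq_zero]
    intro s hs
    exact Subtype.ext (hinj s s.2 (congrArg Subtype.val hs))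
  obtain ⟨t, rfl⟩ := hπ b
  let T : S[X] →+* E := eval₂RingHom S.subtype t
  have hTC : ∀ s : S, T (C s) = s := fun s => by simp [T]
  have hTX : T X = t := by simp [T]
  refine ⟨T.range, lt_of_le_of_ne (fun s hs => ⟨C ⟨s, hs⟩, hTC _⟩) ?_, ?_⟩
  · intro h
    apply hb
    rw [h]
    exact ⟨t, ⟨X, hTX⟩, rfl⟩
  rintro _ ⟨f, rfl⟩ hf
  let g : S[X] := X ^ p - C ⟨t ^ p, hS t⟩
  have hg : g.Monic := monic_X_pow_sub_C _ hp.ne_zero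
  have hTg : T g = 0 := by
    simp only [g, map_sub, map_pow, hTX, hTC, sub_self]
  have hTf : T f = T (f %ₘ g) := by
    conv_lhs => rw [← modByMonic_add_div f g]
    rw [map_add, map_mul, hTg, zero_mul, add_zero]
  have haeval : ∀ r : S[X], π (T r) = aeval (π t) (r.map φ) := by
    intro r
    simp only [T, coe_eval₂RingHom, aeval_def, eval₂_map, hom_eval₂]
    rfl
  let c : K := ⟨π t ^ p, ⟨t ^ p, hS t, map_pow _ _ _⟩⟩
  have hirr : Irreducible (X ^ p - C c : K[X]) := by
    refine X_pow_sub_C_irreducible_of_prime hp fun a ha => hbK ?_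
    have h1 : (a : L) ^ p = π t ^ p := congrArg Subtype.val ha
    have h2 : (a : L) = π t := frobenius_inj L p h1
    rw [← h2]
    exact a.2
  have hmin : X ^ p - C c = minpoly K (π t) :=
    minpoly.eq_of_irreducible_of_monic hirr 
      (by simp only [map_sub, map_pow, aeval_X, aeval_C]; exact sub_self _) (monic_X_pow_sub_C _ hp.ne_zero)
  have : Nontrivial S := φ.domain_nontrivial
  have hr : (f %ₘ g).map φ = 0 := by
    refine eq_zero_of_dvd_of_degree_lt (p := X ^ p - C c) ?_ ?_
    · rw [hmin]
      apply minpoly.dvd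
      rw [← haeval, ← hTf, hf]
    · refine degree_map_le.trans_lt ?_
      rw [degree_X_pow_sub_C hp.pos, ← degree_X_pow_sub_C hp.pos (⟨t ^ p, hS t⟩ : S)]
      exact degree_modByMonic_lt _ hg
  rw [hTf, (Polynomial.map_eq_zero_iff hφ).1 hr, map_zero]

/-- Zorn on subrings that contain all `p`-th powers and meet the kernel trivially, starting from the
subring `E^p`, which qualifies because the kernel squares to zero and `p ≥ 2`. A maximal one maps
onto `L`, and inverting that isomorphism gives the section. -/
theorem exists_section_of_ker_sq_eq_zero (p : ℕ) [Fact p.Prime] [CharP L p] [CharP E p]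
    (π : E →+* L) (hπ : Function.Surjective π)
    (hker : ∀ x y, π x = 0 → π y = 0 → x * y = 0) :
    ∃ σ : L →+* E, π.comp σ = RingHom.id L := by
  have hp : p.Prime := Fact.out
  obtain ⟨S, -, hS⟩ := zorn_le_nonempty₀
    {S : Subring E | (∀ x, x ^ p ∈ S) ∧ ∀ x ∈ S, π x = 0 → x = 0} (by
      intro c hc hchain S₀ hS₀
      refine ⟨sSup c, ⟨fun x => (le_sSup hS₀ : S₀ ≤ _) ((hc hS₀).1 x), ?_⟩, fun S hS => le_sSup hS⟩
      intro x hx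
      rw [Subring.mem_sSup_of_directedOn ⟨S₀, hS₀⟩ hchain.directedOn] at hx
      obtain ⟨S, hS, hxS⟩ := hx
      exact (hc hS).2 x hxS)
    (frobenius E p).range (by
      refine ⟨fun x => ⟨x, rfl⟩, ?_⟩
      rintro _ ⟨x, rfl⟩ hx
      rw [frobenius_def] at hx ⊢
      rw [map_pow] at hx
      have hx0 := eq_zero_of_pow_eq_zero hx
      obtain ⟨m, hm⟩ := Nat.exists_eq_add_of_le hp.two_le
      rw [hm, pow_add, pow_two, hker x x hx0 hx0, zero_mul])
  obtain ⟨⟨hSp, hSinj⟩, hmax⟩ := hS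
  have hsurj : ∀ b, b ∈ S.map π := by
    intro b
    by_contra hb
    obtain ⟨S', hlt, hS'⟩ := exists_subring_lt p π hπ S hSp hSinj b hb
    exact hlt.not_ge (hmax ⟨fun x => hlt.le (hSp x), hS'⟩ hlt.le)
  let e : S ≃+* L := RingEquiv.ofBijective (π.comp S.subtype) ⟨by
    rw [injective_iff_map_eq_zero]
    exact fun s hs => Subtype.ext (hSinj s s.2 hs), fun b => by
      obtain ⟨s, hs, h⟩ := hsurj b
      exact ⟨⟨s, hs⟩, h⟩⟩
  refine ⟨S.subtype.comp e.symm.toRingHom, ?_⟩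
  ext b
  exact e.apply_symm_apply b

theorem formallySmooth_zmod (p : ℕ) [Fact p.Prime] (L : Type*) [Field L] [Algebra (ZMod p) L] :
    Algebra.FormallySmooth (ZMod p) L := by
  let f : MvPolynomial L (ZMod p) →ₐ[ZMod p] L := MvPolynomial.aeval id
  have hf : Function.Surjective f := fun x => ⟨MvPolynomial.X x, by simp [f]⟩
  have hker : Function.Surjective f.kerSquareLift := fun x => by
    obtain ⟨y, rfl⟩ := hf x
    exact ⟨Ideal.Quotient.mk _ y, rfl⟩
  have : Nontrivial (MvPolynomial L (ZMod p) ⧸ RingHom.ker f.toRingHom ^ 2) :=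
    f.kerSquareLift.toRingHom.domain_nontrivial
  have : CharP (MvPolynomial L (ZMod p) ⧸ RingHom.ker f.toRingHom ^ 2) p :=
    charP_of_injective_algebraMap (algebraMap (ZMod p) _).injective p
  have : CharP L p := charP_of_injective_algebraMap (algebraMap (ZMod p) L).injective p
  obtain ⟨σ, hσ⟩ := exists_section_of_ker_sq_eq_zero p f.kerSquareLift.toRingHom hker (by
    intro x y hx hy
    obtain ⟨x, rfl⟩ := Ideal.Quotient.mk_surjective x
    obtain ⟨y, rfl⟩ := Ideal.Quotient.mk_surjective y
    rw [← map_mul, Ideal.Quotient.eq_zero_iff_mem, pow_two]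
    exact Ideal.mul_mem_mul hx hy)
  refine Algebra.FormallySmooth.of_split f
    { σ with commutes' := fun r => RingHom.congr_fun (RingHom.ext_zmod (σ.comp (algebraMap _ _))
        (algebraMap _ _)) r } ?_
  ext x
  exact RingHom.congr_fun hσ x

end Section

/-! ### A Jacobian criterion with derivations over `F_p`. -/

section Jacobian

open IsLocalRing TensorProduct KaehlerDifferential

/-- `A` and its residue field `κ` are formally smooth over `F_p`, so the conormal map from the
cotangent space to `κ ⊗ Ω` has a retraction. -/
theorem exists_kaehlerDifferential_to_cotangentSpace (p : ℕ) [Fact p.Prime] (A : Type*)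
    [CommRing A] [IsLocalRing A] [Algebra (ZMod p) A] [Algebra.FormallySmooth (ZMod p) A] :
    ∃ l : Ω[A⁄ZMod p] →ₗ[A] CotangentSpace A,
      ∀ x : maximalIdeal A, l (D (ZMod p) A x) = (maximalIdeal A).toCotangent x := by
  have := formallySmooth_zmod p (ResidueField A)
  obtain ⟨l, hl⟩ := (Algebra.FormallySmooth.iff_split_injection (R := ZMod p) (P := A)
    (A := ResidueField A) residue_surjective).1 inferInstance
  have hker : RingHom.ker (algebraMap A (ResidueField A)) = maximalIdeal A := ker_residue
  refine ⟨(Ideal.Cotangent.equivOfEq _ _ hker).toLinearMap ∘ₗ l ∘ₗ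
    TensorProduct.mk A (ResidueField A) (Ω[A⁄ZMod p]) 1, fun x => ?_⟩
  have h := LinearMap.congr_fun hl (Ideal.toCotangent _ ⟨x, hker.symm ▸ (x.2 : (x : A) ∈ maximalIdeal A)⟩)
  rw [LinearMap.comp_apply, kerCotangentToTensor_toCotangent, LinearMap.id_apply] at h
  simp only [LinearMap.comp_apply, TensorProduct.mk_apply, h]
  rfl

theorem exists_dual_family {K V ι : Type*} [Field K] [AddCommGroup V] [Module K V]
    [DecidableEq ι] {v : ι → V} (hv : LinearIndependent K v) :
    ∃ l : ι → V →ₗ[K] K, ∀ i j, l i (v j) = if i = j then 1 else 0 := by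
  obtain ⟨g, hg⟩ := LinearMap.exists_extend hv.repr
  refine ⟨fun i => Finsupp.lapply i ∘ₗ g, fun i j => ?_⟩
  have h := LinearMap.congr_fun hg ⟨v j, Submodule.subset_span (Set.mem_range_self j)⟩
  have h2 : hv.repr ⟨v j, Submodule.subset_span (Set.mem_range_self j)⟩ = Finsupp.single j 1 :=
    hv.repr_eq_single j _ rfl
  rw [LinearMap.comp_apply, h2, Submodule.subtype_apply] at h
  rw [LinearMap.comp_apply, h, Finsupp.lapply_apply, Finsupp.single_apply]
  simp only [eq_comm]

variable {R : Type*} [CommRing R]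

/-- Functionals dual to the classes of the `g i` give maps from `Ω` to the residue field of `Q` with
identity matrix on the `D (f j)`. Up to a common denominator `c ∉ Q` they lift to derivations of `R`
on these elements, and the matrix becomes `c` times the identity modulo `Q`. -/
theorem exists_derivations (p : ℕ) [Fact p.Prime] [Algebra (ZMod p) R]
    [Algebra.FormallySmooth (ZMod p) R] (Q : Ideal R) [Q.IsPrime] {s : ℕ} (f : Fin s → R)
    (g : Fin s → maximalIdeal (Localization.AtPrime Q))
    (hfg : ∀ i, (g i : Localization.AtPrime Q) = algebraMap R _ (f i))
    (hg : LinearIndependent (ResidueField (Localization.AtPrime Q))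
      fun i => (maximalIdeal (Localization.AtPrime Q)).toCotangent (g i)) :
    ∃ d : Fin s → Derivation (ZMod p) R R, (Matrix.of fun i j => d i (f j)).det ∉ Q := by
  classical
  obtain ⟨l, hl⟩ := exists_kaehlerDifferential_to_cotangentSpace p (Localization.AtPrime Q)
  obtain ⟨lam, hlam⟩ := exists_dual_family hg
  let δ : Fin s → Ω[R⁄ZMod p] → Q.ResidueField := fun i ω =>
    lam i (l (KaehlerDifferential.map (ZMod p) (ZMod p) R (Localization.AtPrime Q) ω))
  have hδadd : ∀ i a b, δ i (a + b) = δ i a + δ i b := fun i a b => by simp [δ]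
  have hδsmul : ∀ i (r : R) a, δ i (r • a) = algebraMap R Q.ResidueField r * δ i a := by
    intro i r a
    simp only [δ]
    rw [map_smul, ← algebraMap_smul (Localization.AtPrime Q) r, map_smul,
      ← algebraMap_smul (ResidueField (Localization.AtPrime Q)) (algebraMap R _ r), map_smul,
      smul_eq_mul]
    rfl
  let δ' : Fin s → Ω[R⁄ZMod p] →ₗ[R] Q.ResidueField := fun i =>
    { toFun := δ i
      map_add' := hδadd i
      map_smul' := fun r a => by rw [hδsmul, Algebra.smul_def]; rfl }
  have hδ : ∀ i j, δ' i (D (ZMod p) R (f j)) = if i = j then 1 else 0 := by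
    intro i j
    change δ i _ = _
    simp only [δ]
    rw [KaehlerDifferential.map_D, ← hfg, hl, hlam]
  -- `Ω` is projective but may fail to be finitely generated. Embedding it in a free module leaves
  -- only the finite set `S` of coordinates occurring in the `D (f j)`, so finitely many values have
  -- to be lifted.
  obtain ⟨sec, hsec⟩ := (inferInstance : Module.Projective R (Ω[R⁄ZMod p])).out
  let S : Finset (Ω[R⁄ZMod p]) := Finset.univ.biUnion fun j => (sec (D (ZMod p) R (f j))).support
  have hlift : ∀ x : Q.ResidueField, ∃ a : Localization.AtPrime Q, residue _ a = x :=
    fun x => residue_surjective x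
  choose a ha using fun (i : Fin s) (w : Ω[R⁄ZMod p]) => hlift (δ' i w)
  obtain ⟨c, hc⟩ := IsLocalization.exist_integer_multiples Q.primeCompl
    (Finset.univ ×ˢ S) fun x : Fin s × Ω[R⁄ZMod p] => a x.1 x.2
  have hr : ∀ i w, ∃ r : R, w ∈ S → algebraMap R Q.ResidueField r =
      algebraMap R Q.ResidueField c * δ' i w := by
    intro i w
    by_cases hw : w ∈ S
    · obtain ⟨r, hr⟩ := hc (i, w) (Finset.mem_product.2 ⟨Finset.mem_univ _, hw⟩)
      refine ⟨r, fun _ => ?_⟩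
      have := congrArg (residue (Localization.AtPrime Q)) hr
      rw [Algebra.smul_def, map_mul, ha] at this
      exact this
    · exact ⟨0, fun h => (hw h).elim⟩
  choose r hr using hr
  let d : Fin s → Derivation (ZMod p) R R := fun i =>
    (∑ w ∈ S, r i w • (Finsupp.lapply w ∘ₗ sec)).compDer (D (ZMod p) R)
  refine ⟨d, fun hdet => ?_⟩
  have hd : ∀ i j, algebraMap R Q.ResidueField (d i (f j)) =
      if i = j then algebraMap R Q.ResidueField c else 0 := by
    intro i j
    have h1 : d i (f j) = ∑ w ∈ S, r i w * sec (D (ZMod p) R (f j)) w := by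
      simp [d]
    have h2 : δ' i (D (ZMod p) R (f j)) =
        ∑ w ∈ S, algebraMap R Q.ResidueField (sec (D (ZMod p) R (f j)) w) * δ' i w := by
      conv_lhs => rw [← hsec (D (ZMod p) R (f j)), Finsupp.linearCombination_apply]
      rw [Finsupp.sum_of_support_subset (s := S) _ _ _ (by simp), map_sum]
      · refine Finset.sum_congr rfl fun w _ => ?_
        rw [map_smul, Algebra.smul_def, id]
      · exact Finset.subset_biUnion_of_mem (fun j => (sec (D (ZMod p) R (f j))).support)
          (Finset.mem_univ j)
    rw [hδ] at h2
    rw [h1, map_sum]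
    have h3 : (if i = j then algebraMap R Q.ResidueField c else 0) =
        algebraMap R Q.ResidueField c * if i = j then 1 else 0 := by simp
    rw [h3, h2, Finset.mul_sum]
    refine Finset.sum_congr rfl fun w hw => ?_
    rw [map_mul, hr i w hw]
    ring
  rw [← Ideal.algebraMap_residueField_eq_zero, RingHom.map_det] at hdet
  have hM : (algebraMap R Q.ResidueField).mapMatrix (Matrix.of fun i j => d i (f j)) =
      Matrix.diagonal fun _ => algebraMap R Q.ResidueField c := by
    ext i j
    rw [RingHom.mapMatrix_apply, Matrix.map_apply, Matrix.of_apply, hd, Matrix.diagonal_apply]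
  rw [hM, Matrix.det_diagonal, Finset.prod_const] at hdet
  exact c.2 (Ideal.algebraMap_residueField_eq_zero.1 (eq_zero_of_pow_eq_zero hdet))

theorem derivation_mem_of_mem_sq {F : Type*} [CommRing F] [Algebra F R] (d : Derivation F R R)
    {Q : Ideal R} {x : R} (hx : x ∈ Q ^ 2) : d x ∈ Q := by
  rw [pow_two] at hx
  refine Submodule.mul_induction_on hx (fun a ha b hb => ?_) fun a b ha hb => ?_
  · rw [Derivation.leibniz]
    exact Q.add_mem (Q.mul_mem_right _ ha) (Q.mul_mem_right _ hb)
  · rw [map_add]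
    exact Q.add_mem ha hb

/-- Clearing denominators in a linear relation puts `v * ∑ r i * f i` in `Q^2` with `v ∉ Q`. Each `d
i` sends `Q^2` to `Q`, so the matrix of derivatives kills `r` modulo `Q`; it is invertible there. -/
theorem linearIndependent_toCotangent_of_det {F : Type*} [CommRing F] [Algebra F R]
    (Q : Ideal R) [Q.IsPrime] {s : ℕ} (f : Fin s → R) (hfQ : ∀ i, f i ∈ Q)
    (g : Fin s → maximalIdeal (Localization.AtPrime Q))
    (hfg : ∀ i, (g i : Localization.AtPrime Q) = algebraMap R _ (f i))
    (d : Fin s → Derivation F R R) (hd : (Matrix.of fun i j => d i (f j)).det ∉ Q) :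
    LinearIndependent (ResidueField (Localization.AtPrime Q))
      fun i => (maximalIdeal (Localization.AtPrime Q)).toCotangent (g i) := by
  rw [Fintype.linearIndependent_iff]
  intro a ha
  choose b hb using fun i => residue_surjective (a i)
  obtain ⟨t, ht⟩ := IsLocalization.exist_integer_multiples_of_finite Q.primeCompl b
  choose r hr using ht
  have hmem : algebraMap R (Localization.AtPrime Q) (∑ i, r i * f i) ∈
      (Q ^ 2).map (algebraMap R (Localization.AtPrime Q)) := by
    have h1 : (maximalIdeal (Localization.AtPrime Q)).toCotangent (∑ i, b i • g i) = 0 := by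
      rw [map_sum, ← ha]
      refine Finset.sum_congr rfl fun i _ => ?_
      rw [map_smul, ← hb]
      rfl
    rw [Ideal.toCotangent_eq_zero] at h1
    have hsq : maximalIdeal (Localization.AtPrime Q) ^ 2 =
        (Q ^ 2).map (algebraMap R (Localization.AtPrime Q)) := by
      rw [Ideal.map_pow, Localization.AtPrime.map_eq_maximalIdeal]
    replace h1 := hsq.le h1
    have h2 : algebraMap R (Localization.AtPrime Q) (∑ i, r i * f i) =
        algebraMap R _ t * ((∑ i, b i • g i : maximalIdeal (Localization.AtPrime Q)) :
          Localization.AtPrime Q) := by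
      simp only [map_sum, map_mul, hr, AddSubmonoidClass.coe_finsetSum, Finset.mul_sum,
        Submodule.coe_smul, smul_eq_mul, hfg, Algebra.smul_def, mul_assoc]
    rw [h2]
    exact Ideal.mul_mem_left _ _ h1
  rw [IsLocalization.algebraMap_mem_map_algebraMap_iff Q.primeCompl] at hmem
  obtain ⟨v, hv, hmem⟩ := hmem
  have hvec : ((algebraMap R Q.ResidueField).mapMatrix (Matrix.of fun i j => d i (f j))).mulVec
      (fun j => algebraMap R Q.ResidueField (r j)) = 0 := by
    ext i
    have h1 := derivation_mem_of_mem_sq (d i) hmem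
    have h2 : (∑ j, d i (f j) * r j) ∈ Q := by
      have hsum : ∑ j, r j * f j ∈ Q := Q.sum_mem fun j _ => Q.mul_mem_left _ (hfQ j)
      rw [Derivation.leibniz, smul_eq_mul, smul_eq_mul,
        Ideal.add_mem_iff_left _ (Q.mul_mem_right _ hsum)] at h1
      have h3 := ((inferInstance : Q.IsPrime).mem_or_mem h1).resolve_left hv
      have h4 : d i (∑ j, r j * f j) = ∑ j, d i (f j) * r j + ∑ j, f j * d i (r j) := by
        rw [map_sum, ← Finset.sum_add_distrib]
        refine Finset.sum_congr rfl fun j _ => ?_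
        rw [Derivation.leibniz, smul_eq_mul, smul_eq_mul, mul_comm (r j)]
      rwa [h4, Ideal.add_mem_iff_left _ (Q.sum_mem fun j _ => Q.mul_mem_right _ (hfQ j))] at h3
    rw [← Ideal.algebraMap_residueField_eq_zero, map_sum] at h2
    simpa [Matrix.mulVec, dotProduct] using h2
  have hdet : ((algebraMap R Q.ResidueField).mapMatrix
      (Matrix.of fun i j => d i (f j))).det ≠ 0 := by
    rw [← RingHom.map_det]
    exact fun h => hd (Ideal.algebraMap_residueField_eq_zero.1 h)
  have hr0 := Matrix.eq_zero_of_mulVec_eq_zero hdet hvec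
  intro i
  have h1 : algebraMap R Q.ResidueField (r i) = 0 := congrFun hr0 i
  have h2 : algebraMap R Q.ResidueField (r i) = algebraMap R Q.ResidueField t * a i := by
    have := congrArg (residue (Localization.AtPrime Q)) (hr i)
    rw [Algebra.smul_def, map_mul, hb] at this
    exact this
  rw [h2] at h1
  exact (mul_eq_zero.1 h1).resolve_left fun h =>
    t.2 (Ideal.algebraMap_residueField_eq_zero.1 h)

end Jacobian

/-! ### The singular locus is closed and localizes. -/

section SingularLocus

open IsLocalRing

variable {R : Type*} [CommRing R]

/-- The ring `R / P` is regular at the prime `Q / P`. -/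
abbrev IsRegularAt (P Q : Ideal R) [Q.IsPrime] : Prop :=
  IsRegularLocalRing (Localization.AtPrime Q ⧸ P.map (algebraMap R (Localization.AtPrime Q)))

theorem isRegularLocalRing_iff_of_ringEquiv {A B : Type*} [CommRing A] [CommRing B] (e : A ≃+* B) :
    IsRegularLocalRing A ↔ IsRegularLocalRing B :=
  ⟨fun _ => .of_ringEquiv e, fun _ => .of_ringEquiv e.symm⟩

theorem isRegularLocalRing_localization_quotient_iff (P : Ideal R) (x : Ideal (R ⧸ P)) [x.IsPrime] :
    IsRegularLocalRing (Localization.AtPrime x) ↔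
      IsRegularAt P (x.comap (Ideal.Quotient.mk P)) := by
  set Q := x.comap (Ideal.Quotient.mk P) with hQ
  have hM : Algebra.algebraMapSubmonoid (R ⧸ P) Q.primeCompl = x.primeCompl := by
    ext y
    constructor
    · rintro ⟨z, hz, rfl⟩
      exact hz
    · intro hy
      obtain ⟨z, rfl⟩ := Ideal.Quotient.mk_surjective y
      exact ⟨z, hy, rfl⟩
  have : IsLocalization x.primeCompl
      (Localization.AtPrime Q ⧸ P.map (algebraMap R (Localization.AtPrime Q))) := by
    rw [← hM]
    infer_instance
  exact isRegularLocalRing_iff_of_ringEquiv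
    (IsLocalization.algEquiv x.primeCompl (Localization.AtPrime x)
      (Localization.AtPrime Q ⧸ P.map (algebraMap R (Localization.AtPrime Q)))).toRingEquiv

theorem mem_singularIdeal_iff {P : Ideal R} {r : R} :
    r ∈ singularIdeal P ↔
      ∀ (Q : Ideal R) [Q.IsPrime], P ≤ Q → ¬ IsRegularAt P Q → r ∈ Q := by
  rw [singularIdeal, Ideal.mem_comap, PrimeSpectrum.mem_vanishingIdeal]
  constructor
  · intro h Q _ hPQ hQ
    have hker : RingHom.ker (Ideal.Quotient.mk P) ≤ Q := by rwa [Ideal.mk_ker]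
    have hprime : (Q.map (Ideal.Quotient.mk P)).IsPrime :=
      Ideal.map_isPrime_of_surjective Ideal.Quotient.mk_surjective hker
    have hcomap : (Q.map (Ideal.Quotient.mk P)).comap (Ideal.Quotient.mk P) = Q := by
      rw [Ideal.comap_map_of_surjective _ Ideal.Quotient.mk_surjective,
        ← RingHom.ker_eq_comap_bot, sup_eq_left.2 hker]
    have h1 := h ⟨_, hprime⟩ (by
      change ¬ IsRegularLocalRing _
      rw [isRegularLocalRing_localization_quotient_iff]
      simpa only [hcomap] using hQ)
    rw [← hcomap]
    exact h1
  · intro h x hx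
    refine h (x.asIdeal.comap (Ideal.Quotient.mk P)) ?_ ?_
    · intro y hy
      rw [Ideal.mem_comap, Ideal.Quotient.eq_zero_iff_mem.2 hy]
      exact zero_mem _
    · rwa [← isRegularLocalRing_localization_quotient_iff]

/-- Clearing denominators rescales the generators by units of the local ring, which changes neither
independence nor span. -/
theorem exists_lift_generators (P Q : Ideal R) [Q.IsPrime] {s : ℕ}
    (g : Fin s → maximalIdeal (Localization.AtPrime Q))
    (hg : LinearIndependent (ResidueField (Localization.AtPrime Q))
      fun i => (maximalIdeal (Localization.AtPrime Q)).toCotangent (g i))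
    (hspan : Ideal.span (Set.range fun i => (g i : Localization.AtPrime Q)) =
      P.map (algebraMap R (Localization.AtPrime Q))) :
    ∃ (f : Fin s → R) (g' : Fin s → maximalIdeal (Localization.AtPrime Q)),
      (∀ i, f i ∈ P) ∧ (∀ i, (g' i : Localization.AtPrime Q) = algebraMap R _ (f i)) ∧
      (LinearIndependent (ResidueField (Localization.AtPrime Q))
        fun i => (maximalIdeal (Localization.AtPrime Q)).toCotangent (g' i)) ∧
      (Ideal.span (Set.range f)).map (algebraMap R (Localization.AtPrime Q)) =
        P.map (algebraMap R (Localization.AtPrime Q)) := by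
  have hmem : ∀ i, ∃ (a : R) (t : Q.primeCompl), a ∈ P ∧
      (g i : Localization.AtPrime Q) * algebraMap R _ t = algebraMap R _ a := by
    intro i
    have : (g i : Localization.AtPrime Q) ∈ P.map (algebraMap R (Localization.AtPrime Q)) :=
      hspan ▸ Ideal.subset_span (Set.mem_range_self i)
    obtain ⟨⟨a, t⟩, h⟩ := (IsLocalization.mem_map_algebraMap_iff Q.primeCompl _).1 this
    exact ⟨a, t, a.2, h⟩
  choose f t hfP hft using hmem
  have hunit : ∀ i, IsUnit (algebraMap R (Localization.AtPrime Q) (t i)) :=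
    fun i => IsLocalization.map_units _ (t i)
  refine ⟨f, fun i => algebraMap R (Localization.AtPrime Q) (t i) • g i, hfP, ?_, ?_, ?_⟩
  · intro i
    rw [Submodule.coe_smul, smul_eq_mul, mul_comm, hft]
  · have h := hg.units_smul fun i => ((hunit i).map (residue _)).unit
    convert h using 1
    ext i
    rw [map_smul]
    rfl
  · refine le_antisymm (Ideal.map_mono (Ideal.span_le.2 ?_)) ?_
    · rintro _ ⟨i, rfl⟩
      exact hfP i
    · rw [← hspan, Ideal.span_le]
      rintro _ ⟨i, rfl⟩
      rw [SetLike.mem_coe, ← Ideal.unit_mul_mem_iff_mem _ (hunit i), mul_comm, hft]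
      exact Ideal.mem_map_of_mem _ (Ideal.subset_span (Set.mem_range_self i))

theorem exists_notMem_mul_mem (P I Q : Ideal R) [Q.IsPrime] (hP : P.FG)
    (h : P.map (algebraMap R (Localization.AtPrime Q)) ≤
      I.map (algebraMap R (Localization.AtPrime Q))) :
    ∃ u ∉ Q, ∀ x ∈ P, u * x ∈ I := by
  have hx : ∀ x ∈ P, ∃ u ∈ Q.primeCompl, u * x ∈ I := fun x hx =>
    (IsLocalization.algebraMap_mem_map_algebraMap_iff Q.primeCompl _ _ _).1
      (h (Ideal.mem_map_of_mem _ hx))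
  obtain ⟨G, rfl⟩ := hP
  classical
  choose! t ht h using hx
  refine ⟨∏ y ∈ G, t y, Submonoid.prod_mem Q.primeCompl
    fun y hy => ht y (Ideal.subset_span hy), fun x hx => ?_⟩
  have hle : Ideal.span (G : Set R) ≤ I.colon {∏ y ∈ G, t y} := by
    rw [Ideal.span_le]
    intro y hy
    rw [SetLike.mem_coe, Submodule.mem_colon_singleton, smul_eq_mul, mul_comm,
      ← Finset.mul_prod_erase G t hy, mul_comm (t y), mul_assoc]
    exact Ideal.mul_mem_left _ _ (h y (Ideal.subset_span hy))
  have := hle hx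
  rwa [Submodule.mem_colon_singleton, smul_eq_mul, mul_comm] at this

/-- The regular locus of `R / P` is open. -/
theorem exists_notMem_forall_isRegularAt [IsRegularRing R] (p : ℕ) [Fact p.Prime]
    [Algebra (ZMod p) R] [Algebra.FormallySmooth (ZMod p) R] (P Q : Ideal R) [Q.IsPrime]
    (h : IsRegularAt P Q) :
    ∃ c ∉ Q, ∀ (Q' : Ideal R) [Q'.IsPrime], P ≤ Q' → c ∉ Q' → IsRegularAt P Q' := by
  obtain ⟨s, g₀, hg₀, hspan⟩ := exists_linearIndependent_span_eq
    (P.map (algebraMap R (Localization.AtPrime Q)))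
  obtain ⟨f, g, hfP, hgf, hg, hmap⟩ := exists_lift_generators P Q g₀ hg₀ hspan
  obtain ⟨d, hd⟩ := exists_derivations p Q f g hgf hg
  obtain ⟨u, hu, huP⟩ := exists_notMem_mul_mem P (Ideal.span (Set.range f)) Q
    (IsNoetherian.noetherian _) hmap.ge
  -- Where `u` is invertible, the `f i` generate `P`; where the determinant is, they are independent
  -- in the cotangent space.
  refine ⟨u * (Matrix.of fun i j => d i (f j)).det,
    fun hmem => ((inferInstance : Q.IsPrime).mem_or_mem hmem).elim hu hd, ?_⟩
  intro Q' _ hPQ' hc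
  have hu' : u ∉ Q' := fun h => hc (Q'.mul_mem_right _ h)
  have hd' : (Matrix.of fun i j => d i (f j)).det ∉ Q' := fun h => hc (Q'.mul_mem_left _ h)
  have hfQ' : ∀ i, f i ∈ Q' := fun i => hPQ' (hfP i)
  let g' : Fin s → maximalIdeal (Localization.AtPrime Q') := fun i =>
    ⟨algebraMap R _ (f i), by
      rw [← Localization.AtPrime.map_eq_maximalIdeal]
      exact Ideal.mem_map_of_mem _ (hfQ' i)⟩
  have hli := linearIndependent_toCotangent_of_det Q' f hfQ' g' (fun _ => rfl) d hd'
  have hP' : Ideal.span (Set.range fun i => (g' i : Localization.AtPrime Q')) =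
      P.map (algebraMap R (Localization.AtPrime Q')) := by
    apply le_antisymm
    · rw [Ideal.span_le]
      rintro _ ⟨i, rfl⟩
      exact Ideal.mem_map_of_mem _ (hfP i)
    · rw [Ideal.map_le_iff_le_comap]
      intro x hx
      have hunit : IsUnit (algebraMap R (Localization.AtPrime Q') u) :=
        IsLocalization.map_units (Localization.AtPrime Q') (⟨u, hu'⟩ : Q'.primeCompl)
      rw [Ideal.mem_comap, ← Ideal.unit_mul_mem_iff_mem _ hunit, ← map_mul]
      have hr : (Set.range fun i => (g' i : Localization.AtPrime Q')) =
          algebraMap R (Localization.AtPrime Q') '' Set.range f := by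
        rw [← Set.range_comp]; rfl
      rw [hr, ← Ideal.map_span]
      exact Ideal.mem_map_of_mem _ (huP x hx)
  have := (isRegularLocalRing_quotient_span g' hli).1
  rwa [hP'] at this

theorem not_isRegularAt_of_singularIdeal_le [IsRegularRing R] (p : ℕ) [Fact p.Prime]
    [Algebra (ZMod p) R] [Algebra.FormallySmooth (ZMod p) R] {P Q : Ideal R} [Q.IsPrime]
    (hQ : singularIdeal P ≤ Q) : ¬ IsRegularAt P Q := by
  intro h
  obtain ⟨c, hc, hreg⟩ := exists_notMem_forall_isRegularAt p P Q h
  refine hc (hQ (mem_singularIdeal_iff.2 fun Q' _ hPQ' hQ' => ?_))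
  by_contra hcQ'
  exact hQ' (hreg Q' hPQ' hcQ')

theorem isRadical_singularIdeal (P : Ideal R) : (singularIdeal P).IsRadical := by
  rintro r ⟨m, hm⟩
  rw [mem_singularIdeal_iff] at hm ⊢
  intro Q hQprime hPQ hQ
  exact hQprime.mem_of_pow_mem _ (hm Q hPQ hQ)

variable (𝔭 : Ideal R) [𝔭.IsPrime]

theorem isRegularAt_map_iff (P : Ideal R) (Q : Ideal (Localization.AtPrime 𝔭)) [Q.IsPrime] :
    IsRegularAt (P.map (algebraMap R (Localization.AtPrime 𝔭))) Q ↔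
      IsRegularAt P (Q.comap (algebraMap R (Localization.AtPrime 𝔭))) := by
  let e := IsLocalization.localizationLocalizationAtPrimeIsoLocalization 𝔭.primeCompl Q
  refine (isRegularLocalRing_iff_of_ringEquiv (Ideal.quotientEquiv _ _ e.toRingEquiv ?_)).symm
  rw [Ideal.map_map, ← IsScalarTower.algebraMap_eq]
  change _ = Ideal.map e.toAlgHom.toRingHom _
  rw [Ideal.map_map]
  congr 1
  exact e.toAlgHom.comp_algebraMap.symm

/-- The inclusion `≤` is formal. For `≥` the extended ideal is radical, and every prime above it is
singular by openness of the regular locus, so it contains `singularIdeal` of the extension. -/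
theorem map_singularIdeal [IsRegularRing R] (p : ℕ) [Fact p.Prime]
    [Algebra (ZMod p) R] [Algebra.FormallySmooth (ZMod p) R] (P : Ideal R) :
    (singularIdeal P).map (algebraMap R (Localization.AtPrime 𝔭)) =
      singularIdeal (P.map (algebraMap R (Localization.AtPrime 𝔭))) := by
  apply le_antisymm
  · rw [Ideal.map_le_iff_le_comap]
    intro r hr
    rw [Ideal.mem_comap, mem_singularIdeal_iff]
    intro Q _ hPQ hQ
    rw [isRegularAt_map_iff] at hQ
    exact mem_singularIdeal_iff.1 hr _ (Ideal.map_le_iff_le_comap.1 hPQ) hQ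
  · intro z hz
    have hrad : ((singularIdeal P).map (algebraMap R (Localization.AtPrime 𝔭))).radical =
        (singularIdeal P).map (algebraMap R (Localization.AtPrime 𝔭)) := by
      rw [← IsLocalization.map_radical 𝔭.primeCompl, (isRadical_singularIdeal P).radical]
    rw [← hrad, Ideal.radical_eq_sInf, Submodule.mem_sInf]
    rintro Q ⟨hJQ, hQprime⟩
    refine mem_singularIdeal_iff.1 hz Q ?_ ?_
    · exact (Ideal.map_mono (le_singularIdeal P)).trans hJQ
    · rw [isRegularAt_map_iff]
      exact not_isRegularAt_of_singularIdeal_le p (Ideal.map_le_iff_le_comap.1 hJQ)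

end SingularLocus

/-! ### Compatible ideals and the induced map on `R_𝔭`. -/

section Compatible

variable {R : Type*} [CommRing R] [IsDomain R] (𝔭 : Ideal R) [𝔭.IsPrime] {q : ℕ} {π : R → R}

/-- The value does not depend on the chosen fraction: after cross-multiplying, the outer
denominators move inside `π` as `q`-th powers, and the arguments agree. -/
theorem localizedMap_mk' (hq : 0 < q) (hπ : ∀ a f, π (a ^ q * f) = a * π f) (r : R)
    (s : 𝔭.primeCompl) :
    localizedMap q 𝔭 π (IsLocalization.mk' (Localization.AtPrime 𝔭) r s) =
      IsLocalization.mk' (Localization.AtPrime 𝔭) (π (r * (s : R) ^ (q - 1))) s := by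
  rw [localizedMap]
  set z := IsLocalization.mk' (Localization.AtPrime 𝔭) r s with hz
  set r' := (IsLocalization.sec 𝔭.primeCompl z).1
  set s' := (IsLocalization.sec 𝔭.primeCompl z).2
  have h : IsLocalization.mk' (Localization.AtPrime 𝔭) r' s' =
      IsLocalization.mk' (Localization.AtPrime 𝔭) r s := by
    rw [← hz]
    exact IsLocalization.mk'_sec _ z
  rw [IsLocalization.mk'_eq_iff_eq,
    (IsLocalization.injective (Localization.AtPrime 𝔭) 𝔭.primeCompl_le_nonZeroDivisors).eq_iff] at h
  rw [IsLocalization.mk'_eq_iff_eq]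
  congr 1
  obtain ⟨m, rfl⟩ := Nat.exists_eq_succ_of_ne_zero hq.ne'
  rw [← hπ, ← hπ, Nat.succ_sub_one, pow_succ, pow_succ]
  congr 1
  linear_combination ((s : R) ^ m * (s' : R) ^ m) * h

theorem isCompatible_localizedMap_iff (hq : 0 < q) (hπ : ∀ a f, π (a ^ q * f) = a * π f) (u : R)
    (Q : Ideal (Localization.AtPrime 𝔭)) :
    IsCompatible (fun z => localizedMap q 𝔭 π (algebraMap R _ u * z)) Q ↔
      IsCompatible (fun x => π (u * x)) (Q.comap (algebraMap R _)) := by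
  constructor
  · intro h x hx
    have := h _ hx
    dsimp only at this
    rw [← map_mul, ← IsLocalization.mk'_one (M := 𝔭.primeCompl), localizedMap_mk' 𝔭 hq hπ,
      IsLocalization.mk'_mem_iff] at this
    simpa using this
  · intro h z hz
    obtain ⟨x, s, rfl⟩ := IsLocalization.exists_mk'_eq 𝔭.primeCompl z
    rw [IsLocalization.mk'_mem_iff] at hz
    dsimp only
    rw [IsLocalization.mul_mk'_eq_mk'_of_mul, localizedMap_mk' 𝔭 hq hπ,
      IsLocalization.mk'_mem_iff, mul_assoc]
    exact h _ (Ideal.mul_mem_right _ _ hz)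

end Compatible

/-! ### Assembly for polynomial rings. -/

section Main

variable {k : Type*} [Field k] (p : ℕ) [Fact p.Prime] [CharP k p] (e : ℕ) {n : ℕ}
  (u : MvPolynomial (Fin n) k) (𝔭 : Ideal (MvPolynomial (Fin n) k)) [𝔭.IsPrime]

theorem extensions_newPrimes (P : Ideal (MvPolynomial (Fin n) k)) :
    extensions 𝔭 (newPrimes (p ^ e) u P) =
      newPrimes (p ^ e) (algebraMap _ (Localization.AtPrime 𝔭) u)
        (P.map (algebraMap _ (Localization.AtPrime 𝔭))) := by
  -- Formal smoothness of `k[x]` over `F_p` comes from the tower `F_p → k → k[x]`, with no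
  -- finiteness condition on `k`.
  let _ : Algebra (ZMod p) k := ZMod.algebra k p
  have := formallySmooth_zmod p k
  have : Algebra.FormallySmooth (ZMod p) (MvPolynomial (Fin n) k) :=
    .comp (ZMod p) k (MvPolynomial (Fin n) k)
  rw [newPrimes, newPrimes, extensions_union, extensions_minimalPrimes, extensions_minimalPrimes,
    map_starClosure, map_starClosure, map_singularIdeal 𝔭 p, map_colonIdeal]

theorem compatiblePrimes_localizedMap {π : MvPolynomial (Fin n) k → MvPolynomial (Fin n) k}
    (hπ : ∀ a f, π (a ^ p ^ e * f) = a * π f) :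
    compatiblePrimes (p ^ e) (localizedMap (p ^ e) 𝔭 π)
        (algebraMap _ (Localization.AtPrime 𝔭) u) =
      extensions 𝔭 (compatiblePrimes (p ^ e) π u) := by
  have hq : 0 < p ^ e := pow_pos (Fact.out : p.Prime).pos _
  have hIe : Ie (p ^ e) (Ideal.span {algebraMap _ (Localization.AtPrime 𝔭) u}) =
      (Ie (p ^ e) (Ideal.span {u})).map (algebraMap _ (Localization.AtPrime 𝔭)) := by
    rw [map_Ie, Ideal.map_span, Set.image_singleton]
  ext Q
  constructor
  · rintro ⟨hQ, hcomp, hle⟩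
    refine ⟨Q.comap (algebraMap _ _), ⟨hQ.comap _, ?_, ?_⟩, comap_le_of_isPrime 𝔭 hQ,
      (map_comap_localization 𝔭 Q).symm⟩
    · exact (isCompatible_localizedMap_iff 𝔭 hq hπ u Q).1 hcomp
    · rwa [hIe, Ideal.map_le_iff_le_comap] at hle
  · rintro ⟨P, ⟨hP, hcomp, hle⟩, hP𝔭, rfl⟩
    refine ⟨isPrime_map_of_le 𝔭 hP hP𝔭, ?_, ?_⟩
    · refine (isCompatible_localizedMap_iff 𝔭 hq hπ u _).2 ?_
      rwa [comap_map_of_le 𝔭 hP hP𝔭]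
    · rwa [hIe, Ideal.map_le_iff_le_comap, comap_map_of_le 𝔭 hP hP𝔭]

end Main

end KatzmanSchwede

theorem theorem3p11 {k : Type*} [Field k] (p : ℕ) [Fact p.Prime] [CharP k p]
    (n e : ℕ) (he : 0 < e) (u : MvPolynomial (Fin n) k)
    (𝔭 : Ideal (MvPolynomial (Fin n) k)) [𝔭.IsPrime] :
    (∃! A : Set (Ideal (MvPolynomial (Fin n) k)), KatzmanSchwede.IsOutput (p ^ e) u A) ∧
    (∃! A' : Set (Ideal (Localization.AtPrime 𝔭)),
      KatzmanSchwede.IsOutput (p ^ e)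
        (algebraMap (MvPolynomial (Fin n) k) (Localization.AtPrime 𝔭) u) A') ∧
    (∀ (A : Set (Ideal (MvPolynomial (Fin n) k))) (A' : Set (Ideal (Localization.AtPrime 𝔭))),
      KatzmanSchwede.IsOutput (p ^ e) u A →
      KatzmanSchwede.IsOutput (p ^ e)
        (algebraMap (MvPolynomial (Fin n) k) (Localization.AtPrime 𝔭) u) A' →
      A' = KatzmanSchwede.extensions 𝔭 A ∧
      {Q ∈ A' | ¬ KatzmanSchwede.Ie (p ^ e) (Ideal.span
          {algebraMap (MvPolynomial (Fin n) k) (Localization.AtPrime 𝔭) u}) ≤ Q} =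
        KatzmanSchwede.extensions 𝔭
          {P ∈ A | ¬ KatzmanSchwede.Ie (p ^ e) (Ideal.span {u}) ≤ P}) ∧
    (∀ {ι : Type*} (C : Module.Basis ι (KatzmanSchwede.powersSubfield k p e) k) (i₀ : ι),
      C i₀ = 1 →
      KatzmanSchwede.compatiblePrimes (p ^ e)
          (KatzmanSchwede.localizedMap (p ^ e) 𝔭 (KatzmanSchwede.traceMap p e C i₀))
          (algebraMap (MvPolynomial (Fin n) k) (Localization.AtPrime 𝔭) u) =
        KatzmanSchwede.extensions 𝔭
          (KatzmanSchwede.compatiblePrimes (p ^ e)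
            (KatzmanSchwede.traceMap p e C i₀) u)) := by
  have hloc : KatzmanSchwede.extensions 𝔭 (KatzmanSchwede.descendants (p ^ e) u ⊥) =
      KatzmanSchwede.descendants (p ^ e)
        (algebraMap (MvPolynomial (Fin n) k) (Localization.AtPrime 𝔭) u) ⊥ :=
    KatzmanSchwede.extensions_descendants 𝔭 _ _ fun P _ _ =>
      KatzmanSchwede.extensions_newPrimes p e u 𝔭 P
  have : IsNoetherianRing (Localization.AtPrime 𝔭) :=
    IsLocalization.isNoetherianRing 𝔭.primeCompl _ inferInstance
  refine ⟨?_, ?_, ?_, ?_⟩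
  · exact ⟨_, KatzmanSchwede.isOutput_iff.2 rfl, fun A hA => hA.eq_descendants⟩
  · exact ⟨_, KatzmanSchwede.isOutput_iff.2 rfl, fun A hA => hA.eq_descendants⟩
  · intro A A' hA hA'
    obtain rfl := hA.eq_descendants
    obtain rfl := hA'.eq_descendants
    refine ⟨hloc.symm, ?_⟩
    rw [← KatzmanSchwede.extensions_sep_not_le 𝔭
      (fun P hP => KatzmanSchwede.isPrime_of_mem_descendants _ _ Ideal.isPrime_bot hP), hloc,
      KatzmanSchwede.map_Ie, Ideal.map_span, Set.image_singleton]
  · intro ι C i₀ _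
    exact KatzmanSchwede.compatiblePrimes_localizedMap p e u 𝔭
      (KatzmanSchwede.traceMap_pow_mul p e C i₀)
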